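/- **Weighted automata.** Let $\mathcal A=(Q,\Sigma,q_0,\Delta)$ be a $(\min,+)$ weighted automaton, $Q$ and $\Sigma$ finite, with exactly one transition $(p,\sigma,c,q)\in\Delta$, $c\in\mathbb Z\cup\{\infty\}$, for all $p,q\in Q$, $\sigma\in\Sigma$. A run uses transitions of finite weight only, its weight is the sum of their weights, and $\mathrm{mwt}(s\xrightarrow{w}r)$ is the minimal weight of a run on $w$ from $s$ to $r$ ($\infty$ if there is none; we write $s\xrightarrow{w}r$ if it is finite). The *baseline-augmented automaton* has the states $S=\{(q,p,T): T\subseteq Q,\ q,p\in T\}$, the initial state $s_0=(q_0,q_0,\{q_0\})$, the base alphabet $\Gamma=\Delta$, and, on a letter $(p,\sigma,c,q)$ with $c<\infty$, the transitions $(p_1,p,T)\to(p_2,q,T')$ of weight $c'-c$, where $(p_1,\sigma,c',p_2)\in\Delta$ and $T'$ is the set of states reachable from $T$ by reading $\sigma$; all other transitions have weight $\infty$. *Baseline states* are those of the form $(p,p,T)$. Put $\mathfrak m=|S|\cdot|S|!$. **Letters.** We add letters, each with its transitions on $S$ (those not listed have weight $\infty$). For $S'=\{(p,q,T):p\in T\}$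 with $q\in T$ and a word $w$, a *reflexive state* is an $s\in S'$ with $s\xrightarrow{w}s$; it is *minimal reflexive* if $\mathrm{mwt}(s\xrightarrow{w}s)$ is minimal among reflexive states. $(S',w)$ is a *stable cycle* if $w$ leads from $S'$ only to $S'$ and, for each $n\in\mathbb N$, the baseline state $s=(q,q,T)$ is minimal reflexive for $(S',w^n)$ and $\mathrm{mwt}(s\xrightarrow{w^n}s)=0$. A pair $(s,r)\in S'\times S'$ is *grounded* if $s\xrightarrow{w^{\mathfrak m}}g\xrightarrow{w^{\mathfrak m}}r$ for some minimal reflexive state $g$ of $(S',w^{\mathfrak m})$. $(S',w)$ is *degenerate* if $(s,t)$ is grounded whenever $s\in S'$, $t$ is reflexive for $(S',w^{2\mathfrak m})$ and $s\xrightarrow{w^{2\mathfrak m k}}t$ for some $k\ge1$. The *cactus letter* $\alpha_{S',w}$ of a stable cycle has, for each grounded pair $(s,r)$, a transition $s\to r$ of weight $\min_g\big(\mathrm{mwt}(s\xrightarrow{w^{\mathfrak m}}g)+\mathrm{mwt}(g\xrightarrow{w^{\mathfrak m}}r)\big)$ over such $g$. For a grounded pair $s=(q_1,p,T)$, $r=(q_2,p,T)$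 whose $\alpha_{S',w}$-transition has weight $c$, the *rebase letter* $\beta_{S',w,s\to r}$ has a transition $(q',q_1,T)\to(q'',q_2,T)$ of weight $d-c$ for each $\alpha_{S',w}$-transition $(q',p,T)\to(q'',p,T)$ of finite weight $d$. For $s=(q,p_1,T)$, $r=(q,p_2,T)$ in $S$, the *jump letter* $\mathrm{jump}_{s\to r}$ has the transitions $(q',p_1,T)\to(q',p_2,T)$ of weight $0$. Depth: letters of $\Gamma$ have depth $0$, $\mathrm{dep}(\alpha_{S',w})=\mathrm{dep}(\beta_{S',w,s\to r})=1+\mathrm{dep}(w)$, and the depth of a word is the maximal depth of its letters ($0$ for the empty word). **Bounded alphabets.** For $L:\{0,\dots,|S|\}\to\mathbb N$ let $\Upsilon_L$ be the least set which contains $\Gamma$ and every $\alpha_{S',w}$ with $w\in\Upsilon_L^*$, $(S',w)$ a non-degenerate stable cycle, $|w|\le L(\mathrm{dep}(\alpha_{S',w}))$ and $\mathrm{dep}(\alpha_{S',w})\le|S|-1$. Let $\Upsilon_L^{\mathrm{reb}}$ consist of $\Upsilon_L$ and all rebase letters of its cactus letters, and let $\Upsilon_L^{\mathrm{rc}}$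 be the set of all cactus letters $\alpha_{S',w}$ with $w\in(\Upsilon_L^{\mathrm{reb}})^*$, $(S',w)$ a stable cycle and $|w|\le L(\mathrm{dep}(w)+1)$. Let $\Upsilon_L^{\mathrm{rj}}$ consist of $\Upsilon_L^{\mathrm{reb}}$ and all jump letters. **Length bounds.** Let $R(k)$ be the least $R$ such that every colouring of the $2$-element subsets of an $R$-element set with $k$ colours has a homogeneous set of size $3$, let $W$ be the maximal absolute value of a finite transition weight on a letter of $\Gamma$ ($0$ if there is none), and fix $b\in\mathbb N$. Given $H\in\mathbb N$ and $e\in\{0,1\}$, define, for $d\ge0$ and $0\le i\le|S|$, $$\begin{aligned} \mathrm{Len}(0,i)&=1,\qquad \mathrm{Len}(d+1,|S|+1)=b,\\ \mathrm{Len}(d+1,i)&=32\mathfrak m^2\,\mathrm{Len}(d,1)\,\mathrm{Len}(d+1,i+1)\,\big(R(\mathrm{Typ}(d+1,i))+2\big)^{2\mathrm{Amp}(d+1,i)+1},\\ \mathrm{Cov}(d+1,|S|)&=1,\\ \mathrm{Cov}(d+1,i)&=8\mathfrak m^2\big(\mathrm{MaxW}(d)\,\mathrm{Len}(d,1)\,\mathrm{Len}(d+1,i+1)+\mathrm{Cov}(d+1,i+1)+H\big)\quad(i<|S|),\\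 \mathrm{MaxW}(0)&=W,\qquad \mathrm{MaxW}(d+1)=2\mathfrak m\,\mathrm{MaxW}(d)\,\mathrm{Len}(d+1,e),\\ \mathrm{Amp}(d+1,i)&=32\mathfrak m^2\big(H+2\,\mathrm{MaxW}(d)\big)\big(R(\mathrm{Typ}(d+1,i))+\mathrm{Len}(d+1,i+1)+\mathrm{Len}(d,1)\big),\\ \mathrm{Typ}(d+1,i)&=3^i\big(2\,\mathrm{Cov}(d+1,i)+2\big)^{2|S|i}. \end{aligned}$$ The *simple* functions are those for $H=0$, $e=1$. The *general* functions (prefix $\mathrm G$) are those for $H=\mathbf H$, $e=0$, where $\mathbf H$ is the simple $\mathrm{Amp}(|S|,0)$. Put $L_{\mathsf{simp}}(d)=\mathrm{Len}(d,1)$ (simple) and $L_{\mathsf{gen}}(d)=\mathrm{GLen}(d,1)$; an index $L_{\mathsf{simp}}$ or $L_{\mathsf{gen}}$ of an alphabet is written $\mathsf{simp}$ or $\mathsf{gen}$. **Potential and charge.** A word $w$ is *admissible* if it has no jump letters and has a seamless baseline run: a run from $s_0$ on $w$ through baseline states only, each prefix of which has minimal weight among the runs from $s_0$ on the same prefix of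 $w$ to the same state. For an admissible $w$ put $c_w(q)=\mathrm{mwt}(s_0\xrightarrow{w}q)$ for $q\in S$. The *charge* is $\psi(w)=-\min_{q\in S}c_w(q)$. A state $q\in S$ with $c_w(q)<\infty$ is *dominant* if there is a word $z\in(\Upsilon_{\mathsf{simp}}^{\mathrm{rj}})^*\cdot\Upsilon_{\mathsf{gen}}^{\mathrm{rc}}$ on which there is a run from $q$, but none from any $p\in S$ with $c_w(p)<c_w(q)$. The *potential* is $\varphi(w)=\max\{c_w(q): q\text{ dominant}\}$. **Lemma.** For every $b\in\mathbb N$ and every $P\in\mathbb N$: if there are a word $u\in\Upsilon_{\mathsf{gen}}^*$ and a letter $\sigma\in\Upsilon_{\mathsf{gen}}$ of depth $d$ such that $u$ and $u\sigma$ are admissible and $$\psi(u)-\psi(u\sigma)>P+2\,\mathrm{GMaxW}(d),$$ then there is an admissible word $w\in\Gamma^*$ with $\varphi(w)>P$. -/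

import Mathlib

noncomputable section

/-! ### Weighted automata and minimal weights -/

/-- A `(min,+)` weighted automaton with states `Q` and alphabet `Λ`. For all `p, σ, q` there is
exactly one transition from `p` to `q` on `σ`; its weight is `wt p σ q`, where `⊤` is `∞`. -/
structure WFA (Q Λ : Type*) where
  init : Q
  wt : Q → Λ → Q → WithTop ℤ

/-- A table of transition weights for one letter (`⊤` means that there is no transition).
A word enters the definitions of this section as the list of the tables of its letters. -/
abbrev Weights (S : Type*) := S → S → WithTop ℤ

/-- The weight of the sequence of transitions which starts in `s`, reads the letters of `x` and
visits the states `ts` one after the other. It is `⊤` exactly if this is not a run on `x`. -/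
def pathWeight {S : Type*} : S → List (Weights S) → List S → WithTop ℤ
  | _, [], [] => 0
  | s, a :: x, t :: ts => a s t + pathWeight t x ts
  | _, _, _ => ⊤

/-- `mwt x s r` is the minimal weight of a run on `x` from `s` to `r` (`⊤` if there is none);
see `mwt_le_pathWeight` and `exists_pathWeight_eq_mwt`. -/
def mwt {S : Type*} [Fintype S] [DecidableEq S] : List (Weights S) → Weights S
  | [], s, r => if s = r then 0 else ⊤
  | a :: x, s, r => Finset.univ.inf fun t => a s t + mwt x t r

theorem mwt_le_pathWeight {S : Type*} [Fintype S] [DecidableEq S] (x : List (Weights S)) :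
    ∀ (s : S) (ts : List S), mwt x s (ts.getLastD s) ≤ pathWeight s x ts := by
  induction x with
  | nil =>
    intro s ts
    cases ts with
    | nil => simp [mwt, pathWeight]
    | cons t ts => simp [pathWeight]
  | cons a x ih =>
    intro s ts
    cases ts with
    | nil => simp [pathWeight]
    | cons t ts =>
      simp only [mwt, pathWeight, List.getLastD_cons]
      exact (Finset.inf_le (Finset.mem_univ t)).trans (by gcongr; exact ih t ts)

theorem exists_pathWeight_eq_mwt {S : Type*} [Fintype S] [DecidableEq S]
    (x : List (Weights S)) : ∀ s r : S, mwt x s r ≠ ⊤ →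
      ∃ ts : List S, ts.getLastD s = r ∧ pathWeight s x ts = mwt x s r := by
  induction x with
  | nil =>
    intro s r h
    by_cases hsr : s = r
    · exact ⟨[], by simp [hsr], by simp [mwt, pathWeight, hsr]⟩
    · simp [mwt, hsr] at h
  | cons a x ih =>
    intro s r h
    obtain ⟨t, -, ht⟩ := Finset.exists_mem_eq_inf (Finset.univ : Finset S) ⟨s, Finset.mem_univ s⟩
      (fun t => a s t + mwt x t r)
    have hm : mwt (a :: x) s r = a s t + mwt x t r := ht
    rw [hm] at h ⊢
    obtain ⟨ts, h1, h2⟩ := ih t r (fun h0 => h (by simp [h0]))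
    exact ⟨t :: ts, by rw [List.getLastD_cons]; exact h1, by simp [pathWeight, h2]⟩

/-- The word `w ^ n`. -/
def wordPow {L : Type*} (w : List L) (n : ℕ) : List L := (List.replicate n w).flatten

/-- The stabilisation constant `|S| · |S|!`. -/
def stabConst (S : Type*) [Fintype S] : ℕ :=
  Fintype.card S * (Fintype.card S).factorial

/-- `s` is a reflexive state of `(S', x)`: `s ∈ S'` and there is a run on `x` from `s` to `s`. -/
def IsRefState {S : Type*} [Fintype S] [DecidableEq S] (S' : Finset S) (x : List (Weights S))
    (s : S) : Prop :=
  s ∈ S' ∧ mwt x s s ≠ ⊤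

/-- `s` is a minimal reflexive state of `(S', x)`. -/
def IsMinState {S : Type*} [Fintype S] [DecidableEq S] (S' : Finset S) (x : List (Weights S))
    (s : S) : Prop :=
  IsRefState S' x s ∧ ∀ r, IsRefState S' x r → mwt x s s ≤ mwt x r r

/-- `(s, r)` is a grounded pair of `(S', x)`. -/
def IsGrnPair {S : Type*} [Fintype S] [DecidableEq S] (S' : Finset S) (x : List (Weights S))
    (s r : S) : Prop :=
  s ∈ S' ∧ r ∈ S' ∧ ∃ g, IsMinState S' (wordPow x (stabConst S)) g ∧
    mwt (wordPow x (stabConst S)) s g ≠ ⊤ ∧ mwt (wordPow x (stabConst S)) g r ≠ ⊤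

/-- `(S', x)` is degenerate: every pair `(s, t)` with `s ∈ S'`, `t` reflexive for `x ^ (2 m)`, and
a run from `s` to `t` on some `x ^ (2 m k)`, `k ≥ 1`, is grounded (`m` is `stabConst`). -/
def IsDegenerate {S : Type*} [Fintype S] [DecidableEq S] (S' : Finset S)
    (x : List (Weights S)) : Prop :=
  ∀ s ∈ S', ∀ t, IsRefState S' (wordPow x (2 * stabConst S)) t →
    (∃ k, 1 ≤ k ∧ mwt (wordPow x (2 * stabConst S * k)) s t ≠ ⊤) → IsGrnPair S' x s t

open Classical in
/-- The transitions of the cactus letter of `(S', x)`: a grounded pair `(s, r)` gets the minimum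
over all minimal reflexive `g` of the weight of a run `s → g → r` on `x ^ m · x ^ m` (attained by
the grounding state), and a pair that is not grounded gets `⊤`. -/
def stabWeight {S : Type*} [Fintype S] [DecidableEq S] (S' : Finset S)
    (x : List (Weights S)) : Weights S := fun s r =>
  if IsGrnPair S' x s r then
    Finset.univ.inf fun g =>
      if IsMinState S' (wordPow x (stabConst S)) g then
        mwt (wordPow x (stabConst S)) s g + mwt (wordPow x (stabConst S)) g r
      else ⊤
  else ⊤

/-! ### The baseline-augmented automaton -/

/-- States `(q, p, T)` of the baseline-augmented automaton, with `q, p ∈ T`. -/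
abbrev BState (Q : Type*) :=
  {x : Q × Q × Finset Q // x.1 ∈ x.2.2 ∧ x.2.1 ∈ x.2.2}

namespace BState

/-- The inner state. -/
abbrev inner {Q : Type*} (s : BState Q) : Q := s.1.1

/-- The baseline component. -/
abbrev base {Q : Type*} (s : BState Q) : Q := s.1.2.1

/-- The reachable subset. -/
abbrev reach {Q : Type*} (s : BState Q) : Finset Q := s.1.2.2

/-- Baseline states `(p, p, T)`. -/
def IsBaseline {Q : Type*} (s : BState Q) : Prop := s.inner = s.base

/-- For `s = (q, p, T)`, the set of all states `(q', p, T)` with `q' ∈ T`. -/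
def fiber {Q : Type*} [Fintype Q] [DecidableEq Q] (s : BState Q) : Finset (BState Q) :=
  Finset.univ.filter fun t => t.base = s.base ∧ t.reach = s.reach

/-- `(q, p, T)` with the baseline component replaced by `p' ∈ T`. -/
def rebaseTo {Q : Type*} (s : BState Q) (p' : Q) (h : p' ∈ s.reach) : BState Q :=
  ⟨(s.inner, p', s.reach), s.2.1, h⟩

end BState

/-- Stable cycles `(S', x)`: `S' = {(p, q, T) | p ∈ T}` has the baseline state `s = (q, q, T)`,
reading `x` from `S'` leads to `S'` only, and for all `n` the state `s` is minimal reflexive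
for `x ^ n`, with minimal cycle weight `0`. -/
def IsStableCycle {Q : Type*} [Fintype Q] [DecidableEq Q] (S' : Finset (BState Q))
    (x : List (Weights (BState Q))) : Prop :=
  ∃ s : BState Q, s.IsBaseline ∧ S' = s.fiber ∧
    (∀ t ∈ S', ∀ r, mwt x t r ≠ ⊤ → r ∈ S') ∧
    ∀ n : ℕ, IsMinState S' (wordPow x n) s ∧ mwt (wordPow x n) s s = 0

/-- Letters: transitions `(p, σ, q)` of the original automaton (their weight is determined by the
automaton), cactus letters `α_{S', w}`, rebase letters `β_{S', w, s → r}`, and jump letters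
`jump_{s → r}`. This is the raw syntax; the alphabets below single out the legitimate letters. -/
inductive Letter (Q Λ : Type*) where
  | trn (p : Q) (σ : Λ) (q : Q) : Letter Q Λ
  | cactus (S' : Finset (BState Q)) (w : List (Letter Q Λ)) : Letter Q Λ
  | rebase (S' : Finset (BState Q)) (w : List (Letter Q Λ)) (s r : BState Q) : Letter Q Λ
  | jump (s r : BState Q) : Letter Q Λ

namespace Letter

/-- The depth of a letter; the depth of a word is the maximal depth of its letters. -/
def dep {Q Λ : Type*} : Letter Q Λ → ℕ
  | trn _ _ _ => 0
  | cactus _ w => 1 + (w.map fun a => a.dep).foldr max 0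
  | rebase _ w _ _ => 1 + (w.map fun a => a.dep).foldr max 0
  | jump _ _ => 0

/-- The depth of a word (`0` for the empty word). -/
def wordDep {Q Λ : Type*} (w : List (Letter Q Λ)) : ℕ := (w.map fun a => a.dep).foldr max 0

/-- The base alphabet: the transitions of the original automaton. -/
def IsTrn {Q Λ : Type*} : Letter Q Λ → Prop
  | trn _ _ _ => True
  | _ => False

/-- Jump letters. -/
def IsJump {Q Λ : Type*} : Letter Q Λ → Prop
  | jump s r => s.inner = r.inner ∧ s.reach = r.reach
  | _ => False

end Letter

/-- The transitions of the rebase letter for `s = (q₁, p, T)`, `r = (q₂, p, T)`, where `M` is the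
table of the cactus letter: if `M` has a transition `(q', p, T) → (q'', p, T)` of weight `d`, then
there is a transition `(q', q₁, T) → (q'', q₂, T)` of weight `d - M s r`. -/
def rebaseWeight {Q : Type*} [Fintype Q] [DecidableEq Q] (M : Weights (BState Q))
    (s r : BState Q) : Weights (BState Q) := fun t g =>
  if h : t.base = s.inner ∧ t.reach = s.reach ∧ g.base = r.inner ∧ g.reach = s.reach then
    M (t.rebaseTo s.base (h.2.1 ▸ s.2.2)) (g.rebaseTo s.base (h.2.2.2 ▸ s.2.2)) - M s r
  else ⊤

namespace WFA

variable {Q Λ : Type*} [Fintype Q] [DecidableEq Q]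

/-- The set of states reachable from `T` by reading `σ`. -/
def succ (A : WFA Q Λ) (T : Finset Q) (σ : Λ) : Finset Q :=
  Finset.univ.filter fun q => ∃ p ∈ T, A.wt p σ q ≠ ⊤

/-- The transitions of the baseline-augmented automaton on the letter `(p, σ, q)`. -/
def trnWeight (A : WFA Q Λ) (p : Q) (σ : Λ) (q : Q) : Weights (BState Q) := fun s t =>
  if A.wt p σ q ≠ ⊤ ∧ s.base = p ∧ t.base = q ∧ t.reach = A.succ s.reach σ then
    A.wt s.inner σ t.inner - A.wt p σ q
  else ⊤

/-- The transition weights of all letters. -/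
def letterWeight (A : WFA Q Λ) : Letter Q Λ → Weights (BState Q)
  | .trn p σ q => A.trnWeight p σ q
  | .cactus S' w => stabWeight S' (w.map fun a => A.letterWeight a)
  | .rebase S' w s r => rebaseWeight (stabWeight S' (w.map fun a => A.letterWeight a)) s r
  | .jump s r => fun t g =>
      if t.inner = g.inner ∧ t.base = s.base ∧ t.reach = s.reach ∧
        g.base = r.base ∧ g.reach = s.reach then 0 else ⊤

/-- The list of the transition tables of a word. -/
def tables (A : WFA Q Λ) (w : List (Letter Q Λ)) : List (Weights (BState Q)) :=
  w.map A.letterWeight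

/-- The initial state `(q₀, q₀, {q₀})`. -/
def init' (A : WFA Q Λ) : BState Q := ⟨(A.init, A.init, {A.init}), by simp⟩

/-- The configuration that is reached from the initial state by reading `w`. -/
def conf (A : WFA Q Λ) (w : List (Letter Q Λ)) : BState Q → WithTop ℤ :=
  mwt (A.tables w) A.init'

/-! ### Bounded cactus letters -/

/-- The `L`-bounded cactus letters: letters of the base alphabet, and non-degenerate cactus
letters of depth at most `|S| - 1` which are built from bounded cactus letters and whose word is
of length at most `L` of the depth of the letter. -/
inductive BoundedCac (A : WFA Q Λ) (L : ℕ → ℕ) : Letter Q Λ → Prop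
  | trn (p : Q) (σ : Λ) (q : Q) : BoundedCac A L (.trn p σ q)
  | cactus (S' : Finset (BState Q)) (w : List (Letter Q Λ))
      (hw : ∀ a ∈ w, BoundedCac A L a)
      (hstable : IsStableCycle S' (A.tables w))
      (hnondeg : ¬ IsDegenerate S' (A.tables w))
      (hlen : w.length ≤ L (Letter.cactus S' w).dep)
      (hdep : (Letter.cactus S' w).dep ≤ Fintype.card (BState Q) - 1) :
      BoundedCac A L (.cactus S' w)

/-- Bounded cactus letters together with the rebase letters obtained from them. -/
def BoundedCacReb (A : WFA Q Λ) (L : ℕ → ℕ) (a : Letter Q Λ) : Prop :=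
  A.BoundedCac L a ∨ ∃ S' w s r, a = .rebase S' w s r ∧ A.BoundedCac L (.cactus S' w) ∧
    IsGrnPair S' (A.tables w) s r

/-- Cactus letters built from words with letters in `BoundedCacReb` and of bounded length. -/
def BoundedCacRebCac (A : WFA Q Λ) (L : ℕ → ℕ) (a : Letter Q Λ) : Prop :=
  ∃ S' w, a = .cactus S' w ∧ (∀ c ∈ w, A.BoundedCacReb L c) ∧
    IsStableCycle S' (A.tables w) ∧ w.length ≤ L (Letter.wordDep w + 1)

/-- `BoundedCacReb` together with the jump letters. -/
def BoundedCacRebJump (A : WFA Q Λ) (L : ℕ → ℕ) (a : Letter Q Λ) : Prop :=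
  A.BoundedCacReb L a ∨ a.IsJump

end WFA

/-! ### The length bounds -/

/-- `ramsey k n` is the least `R` such that every colouring of the two-element subsets of an
`R`-element set with `k` colours has a homogeneous set with at least `n` elements. -/
def ramsey (k n : ℕ) : ℕ :=
  sInf {R : ℕ | ∀ f : Sym2 (Fin R) → ℕ, (∀ i j, i ≠ j → f s(i, j) < k) →
    ∃ (X : Finset (Fin R)) (c : ℕ), n ≤ X.card ∧ ∀ i ∈ X, ∀ j ∈ X, i ≠ j → f s(i, j) = c}

/-- Parameters of the length bound recursion: `n = |S|`, `m` the stabilisation constant, `W` the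
maximal weight of a base letter, `H` the additive constant, `e` the index `i` at which the maximal
weight refers to the length, and `b` the value of the length at `i = n + 1`. -/
structure BoundParams where
  n : ℕ
  m : ℕ
  W : ℕ
  H : ℕ
  e : ℕ
  b : ℕ

namespace BoundParams

/- The five functions are used with `0 ≤ i ≤ n + 1` only. Outside the ranges in which they are
meant they have arbitrary values. -/
mutual

/-- The length bound. -/
def len (B : BoundParams) : ℕ → ℕ → ℕ
  | 0, _ => 1
  | d + 1, i =>
    if B.n < i then B.b
    else 32 * B.m ^ 2 * len B d 1 * len B (d + 1) (i + 1) *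
      (ramsey (types B (d + 1) i) 3 + 2) ^ (2 * amp B (d + 1) i + 1)
termination_by d i => (d, B.n + 2 - i, 3)

/-- The cover. -/
def cover (B : BoundParams) : ℕ → ℕ → ℕ
  | 0, _ => 1
  | d + 1, i =>
    if B.n ≤ i then 1
    else 8 * B.m ^ 2 * (maxW B d * len B d 1 * len B (d + 1) (i + 1) +
      cover B (d + 1) (i + 1) + B.H)
termination_by d i => (d, B.n + 2 - i, 0)

/-- The maximal weight. -/
def maxW (B : BoundParams) : ℕ → ℕ
  | 0 => B.W
  | d + 1 => 2 * B.m * maxW B d * len B (d + 1) B.e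
termination_by d => (d, B.n + 3, 0)

/-- The amplitude. -/
def amp (B : BoundParams) : ℕ → ℕ → ℕ
  | 0, _ => 0
  | d + 1, i =>
    if B.n < i then 0
    else 32 * B.m ^ 2 * (B.H + 2 * maxW B d) *
      (ramsey (types B (d + 1) i) 3 + len B (d + 1) (i + 1) + len B d 1)
termination_by d i => (d, B.n + 2 - i, 2)

/-- The number of types. -/
def types (B : BoundParams) : ℕ → ℕ → ℕ
  | 0, _ => 0
  | d + 1, i => 3 ^ i * (2 * cover B (d + 1) i + 2) ^ (2 * B.n * i)
termination_by d i => (d, B.n + 2 - i, 1)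

end

end BoundParams

namespace WFA

variable {Q Λ : Type*} [Fintype Q] [DecidableEq Q]

/-- The maximal absolute value of a finite weight of a transition of the baseline-augmented
automaton on a letter of the base alphabet. -/
def maxBaseWeight (A : WFA Q Λ) : ℕ :=
  sSup {k : ℕ | ∃ (p : Q) (σ : Λ) (q : Q) (s t : BState Q) (c : ℤ),
    A.trnWeight p σ q s t = c ∧ k = c.natAbs}

/-- Parameters of the simple bounds. -/
def simpParams (A : WFA Q Λ) (b : ℕ) : BoundParams where
  n := Fintype.card (BState Q)
  m := stabConst (BState Q)
  W := A.maxBaseWeight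
  H := 0
  e := 1
  b := b

/-- Parameters of the general bounds. Here `H` is the simple amplitude at `(|S|, 0)`. -/
def genParams (A : WFA Q Λ) (b : ℕ) : BoundParams where
  n := Fintype.card (BState Q)
  m := stabConst (BState Q)
  W := A.maxBaseWeight
  H := (A.simpParams b).amp (Fintype.card (BState Q)) 0
  e := 0
  b := b

/-- The simple length bound. -/
def simpL (A : WFA Q Λ) (b d : ℕ) : ℕ := (A.simpParams b).len d 1

/-- The general length bound. -/
def genL (A : WFA Q Λ) (b d : ℕ) : ℕ := (A.genParams b).len d 1

/-- The general maximal weight of depth `d`. -/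
def genMaxW (A : WFA Q Λ) (b d : ℕ) : ℕ := (A.genParams b).maxW d

/-! ### Dominance, potential and charge -/

/-- The state `q` is dominant in the configuration `c`: it lies in the support of `c`, and there is
a word which consists of simple letters (possibly rebase and jump letters) followed by one general
cactus letter, which can be read from `q`, and from no state of smaller value. -/
def IsDominant (A : WFA Q Λ) (b : ℕ) (c : BState Q → WithTop ℤ) (q : BState Q) : Prop :=
  c q ≠ ⊤ ∧ ∃ (w : List (Letter Q Λ)) (α : Letter Q Λ),
    (∀ a ∈ w, A.BoundedCacRebJump (A.simpL b) a) ∧ A.BoundedCacRebCac (A.genL b) α ∧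
    (∃ r, mwt (A.tables (w ++ [α])) q r ≠ ⊤) ∧
    ∀ p, c p < c q → ∀ r, mwt (A.tables (w ++ [α])) p r = ⊤

/-- `w` has a seamless baseline run: a run from the initial state through baseline states only,
each of whose prefixes is a run of minimal weight to the state it reaches. -/
def HasSeamlessBaselineRun (A : WFA Q Λ) (w : List (Letter Q Λ)) : Prop :=
  ∃ ts : List (BState Q), pathWeight A.init' (A.tables w) ts ≠ ⊤ ∧
    (∀ t ∈ ts, t.IsBaseline) ∧
    ∀ j ≤ w.length, pathWeight A.init' (A.tables (w.take j)) (ts.take j) =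
      mwt (A.tables (w.take j)) A.init' ((ts.take j).getLastD A.init')

/-- The words for which potential and charge are defined: jump-free words that have a seamless
baseline run. -/
def IsAdmissible (A : WFA Q Λ) (w : List (Letter Q Λ)) : Prop :=
  (∀ a ∈ w, ¬ a.IsJump) ∧ A.HasSeamlessBaselineRun w

/-- The potential of an admissible word: the maximal value of a dominant state. -/
def potential (A : WFA Q Λ) (b : ℕ) (w : List (Letter Q Λ)) : ℤ :=
  sSup {x : ℤ | ∃ q, A.IsDominant b (A.conf w) q ∧ A.conf w q = x}

/-- The charge of an admissible word: the negated minimal value of a state. -/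
def charge (A : WFA Q Λ) (w : List (Letter Q Λ)) : ℤ :=
  -((Finset.univ.inf (A.conf w)).untopD 0)

end WFA

end

/-!
The words `u` and `u ++ [σ]` have a finite least value, and reading `σ` raises this value by more
than `P + 2 * genMaxW b d`. The transitions on `σ` weigh at most `genMaxW b d`
(`WFA.BoundedCac.le_genMaxW`), so every state from which `σ` can be read lies more than `P` above
the least value of `u`. Let `q` be such a state of minimal value, and let `e` be a state of least
value. It remains to turn `u` into a word over the base alphabet whose baseline run ends in `e`:
then `q` has a value above `P`, and it is dominant, because a jump back to the original baseline
followed by `σ` can be read from `q`, and from no state of smaller value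
(`WFA.isDominant_rebaseWord`). If `σ` is not a cactus letter itself, the cactus letter of the empty
word is appended.

The word is obtained in two steps.

* *Unfolding.* A power of the word of a stable cycle has the same weights as the cactus letter on
  the transitions of that letter, and weights beyond any prescribed threshold on all other pairs
  that start in the fiber of the cycle (`IsStableCycle.exists_approx`). Indeed no cycle has negative weight. A long path on which no
  state lies on a cycle of weight `0` is heavy (`linear_growth`). Any other path can be detoured
  along such a cycle so that it meets it at a time divisible by `|S|!`. The two halves of the path
  can then be shortened, by removing cycles of length divisible by `|S|!`, and padded by the cycle
  of weight `0`, to exactly `stabConst` steps each. So the path is at least as heavy as a transition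
  of the cactus letter (`exists_stabilising_power`). By induction on the nesting of cactus letters,
  `u` is approximated by a word over the base alphabet (`WFA.isUnfoldable_mwt`,
  `WFA.BoundedCac.isUnfoldable`): finite values are kept, and new states have values above that
  of `q`.
* *Rebasing.* On the base alphabet the baseline can be replaced by the inner states of any run; this
  subtracts the weight of that run from all weights (`WFA.mwt_rebaseWord`). For an optimal run to
  `e`, the new baseline run is seamless (`WFA.isAdmissible_rebaseWord`).
-/

/-! ### Minimal weights and powers of a table -/

theorem exists_abs_bound {S : Type*} [Fintype S] (M : Weights S) :
    ∃ μ : ℕ, ∀ (s t : S) (v : ℤ), M s t = v → |v| ≤ μ := by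
  refine ⟨∑ s, ∑ t, ((M s t).untopD 0).natAbs, fun s t v h => ?_⟩
  have h1 : ((M s t).untopD 0).natAbs ≤ ∑ t, ((M s t).untopD 0).natAbs :=
    Finset.single_le_sum (f := fun t => ((M s t).untopD 0).natAbs) (by simp) (Finset.mem_univ t)
  have h2 : ∑ t, ((M s t).untopD 0).natAbs ≤ ∑ s, ∑ t, ((M s t).untopD 0).natAbs :=
    Finset.single_le_sum (f := fun s => ∑ t, ((M s t).untopD 0).natAbs) (by simp)
      (Finset.mem_univ s)
  have h3 : ((M s t).untopD 0) = v := by rw [h]; rfl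
  rw [h3] at h1
  rw [Int.abs_eq_natAbs]
  exact_mod_cast h1.trans h2

theorem exists_lower_bound {S : Type*} [Fintype S] (M : Weights S) :
    ∃ μ : ℕ, ∀ s t, ((-(μ : ℤ) : ℤ) : WithTop ℤ) ≤ M s t := by
  obtain ⟨μ, hμ⟩ := exists_abs_bound M
  refine ⟨μ, fun s t => ?_⟩
  cases h : M s t with
  | top => simp
  | coe v => exact WithTop.coe_le_coe.mpr (abs_le.mp (hμ s t v h)).1

section Tropical

variable {S : Type*} [Fintype S] [DecidableEq S]

theorem mwt_cons_le (a : Weights S) (x : List (Weights S)) (s t r : S) :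
    mwt (a :: x) s r ≤ a s t + mwt x t r :=
  Finset.inf_le (Finset.mem_univ t)

theorem exists_mwt_cons (a : Weights S) (x : List (Weights S)) (s r : S) :
    ∃ t, mwt (a :: x) s r = a s t + mwt x t r := by
  obtain ⟨t, -, ht⟩ := Finset.exists_mem_eq_inf (Finset.univ : Finset S) ⟨s, Finset.mem_univ s⟩
    (fun t => a s t + mwt x t r)
  exact ⟨t, ht⟩

theorem mwt_singleton (a : Weights S) : mwt [a] = a := by
  funext s r
  apply le_antisymm
  · simpa [mwt] using mwt_cons_le a [] s r r
  · obtain ⟨t, ht⟩ := exists_mwt_cons a [] s r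
    rw [ht]
    by_cases h : t = r <;> simp [mwt, h]

theorem mwt_append (x y : List (Weights S)) : mwt (x ++ y) = mwt (mwt x :: y) := by
  induction x with
  | nil =>
    funext s r
    apply le_antisymm
    · obtain ⟨t, ht⟩ := exists_mwt_cons (mwt []) y s r
      rw [ht]
      by_cases h : s = t <;> simp [mwt, h]
    · simpa [mwt] using mwt_cons_le (mwt []) y s s r
  | cons a x ih =>
    funext s r
    apply le_antisymm
    · obtain ⟨t, ht⟩ := exists_mwt_cons (mwt (a :: x)) y s r
      obtain ⟨t', ht'⟩ := exists_mwt_cons a x s t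
      rw [ht, ht', add_assoc]
      refine (mwt_cons_le a (x ++ y) s t' r).trans ?_
      rw [ih]
      gcongr
      exact mwt_cons_le _ _ _ _ _
    · obtain ⟨t, ht⟩ := exists_mwt_cons a (x ++ y) s r
      obtain ⟨t', ht'⟩ := exists_mwt_cons (mwt x) y t r
      rw [List.cons_append, ht, ih, ht', ← add_assoc]
      refine (mwt_cons_le _ y s t' r).trans ?_
      gcongr
      exact mwt_cons_le _ _ _ _ _

theorem mwt_append_le (x y : List (Weights S)) (s t r : S) :
    mwt (x ++ y) s r ≤ mwt x s t + mwt y t r := by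
  rw [mwt_append]
  exact mwt_cons_le _ _ _ _ _

theorem exists_mwt_append (x y : List (Weights S)) (s r : S) :
    ∃ t, mwt (x ++ y) s r = mwt x s t + mwt y t r := by
  rw [mwt_append]
  exact exists_mwt_cons _ _ _ _

/-- The `n`-th power of a table in the `(min,+)` semiring: `tropPow M n s r` is the minimal weight
of a path with `n` steps from `s` to `r`. -/
def tropPow (M : Weights S) (n : ℕ) : Weights S := mwt (List.replicate n M)

theorem tropPow_zero_self (M : Weights S) (s : S) : tropPow M 0 s s = 0 := by
  simp [tropPow, mwt]

theorem tropPow_one (M : Weights S) : tropPow M 1 = M := mwt_singleton M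

theorem tropPow_add_le (M : Weights S) (a b : ℕ) (s t r : S) :
    tropPow M (a + b) s r ≤ tropPow M a s t + tropPow M b t r := by
  rw [tropPow, List.replicate_add]
  exact mwt_append_le _ _ _ _ _

theorem exists_tropPow_add (M : Weights S) (a b : ℕ) (s r : S) :
    ∃ t, tropPow M (a + b) s r = tropPow M a s t + tropPow M b t r := by
  rw [tropPow, List.replicate_add]
  exact exists_mwt_append _ _ _ _

theorem exists_tropPow_succ (M : Weights S) (n : ℕ) (s r : S) :
    ∃ t, tropPow M (n + 1) s r = M s t + tropPow M n t r :=
  exists_mwt_cons M _ s r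

theorem tropPow_mono {M M' : Weights S} (h : ∀ s t, M s t ≤ M' s t) (n : ℕ) (s r : S) :
    tropPow M n s r ≤ tropPow M' n s r := by
  induction n generalizing s with
  | zero => rfl
  | succ n ih =>
    obtain ⟨t, ht⟩ := exists_tropPow_succ M' n s r
    rw [ht]
    exact (mwt_cons_le M _ s t r).trans (add_le_add (h _ _) (ih _))

theorem wordPow_succ {L : Type*} (w : List L) (n : ℕ) :
    wordPow w (n + 1) = w ++ wordPow w n := by
  simp [wordPow, List.replicate_succ]

theorem length_wordPow {L : Type*} (w : List L) (n : ℕ) :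
    (wordPow w n).length = n * w.length := by
  simp [wordPow]

theorem mem_of_mem_wordPow {L : Type*} {w : List L} {n : ℕ} {a : L} (h : a ∈ wordPow w n) :
    a ∈ w := by
  obtain ⟨l, hl, hal⟩ := List.mem_flatten.mp h
  rwa [List.eq_of_mem_replicate hl] at hal

theorem mwt_wordPow (x : List (Weights S)) (n : ℕ) :
    mwt (wordPow x n) = tropPow (mwt x) n := by
  induction n with
  | zero => rfl
  | succ n ih =>
    rw [wordPow_succ, mwt_append]
    funext s r
    simp only [tropPow, List.replicate_succ, mwt] at ih ⊢
    rw [ih]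

theorem tropPow_mul_self_le_zero {M : Weights S} {l : ℕ} {t : S} (h : tropPow M l t t ≤ 0)
    (k : ℕ) : tropPow M (l * k) t t ≤ 0 := by
  induction k with
  | zero => simp [tropPow_zero_self]
  | succ k ih =>
    rw [Nat.mul_succ]
    exact (tropPow_add_le M _ _ t t t).trans (by simpa using add_le_add ih h)

/-- A minimal path, as a function of time. -/
theorem exists_path (M : Weights S) (n : ℕ) (s r : S) (h : tropPow M n s r ≠ ⊤) :
    ∃ f : ℕ → S, f 0 = s ∧ f n = r ∧
      tropPow M n s r = ∑ k ∈ Finset.range n, M (f k) (f (k + 1)) := by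
  induction n generalizing s with
  | zero =>
    by_cases hsr : s = r
    · exact ⟨fun _ => s, rfl, hsr, by simp [tropPow, mwt, hsr]⟩
    · simp [tropPow, mwt, hsr] at h
  | succ n ih =>
    obtain ⟨t, ht⟩ := exists_tropPow_succ M n s r
    rw [ht] at h ⊢
    obtain ⟨f, h0, hn, hf⟩ := ih t (fun h0 => h (by simp [h0]))
    refine ⟨fun k => Nat.casesOn k s f, rfl, hn, ?_⟩
    rw [Finset.sum_range_succ', hf, add_comm]
    simp [h0]

theorem tropPow_le_sum (M : Weights S) (f : ℕ → S) (i l : ℕ) :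
    tropPow M l (f i) (f (i + l)) ≤ ∑ k ∈ Finset.Ico i (i + l), M (f k) (f (k + 1)) := by
  induction l with
  | zero => simp [tropPow_zero_self]
  | succ l ih =>
    rw [← add_assoc, Finset.sum_Ico_succ_top (by omega)]
    refine (tropPow_add_le M l 1 _ (f (i + l)) _).trans ?_
    rw [tropPow_one]
    gcongr

/-- A long path passes through a cycle whose length is a multiple of `F`: two of its first
`|S| * F + 1` vertices agree together with their times modulo `F`. -/
theorem exists_cycle (M : Weights S) {F n : ℕ} (hF : 0 < F) (hn : Fintype.card S * F ≤ n)
    {s r : S} (h : tropPow M n s r ≠ ⊤) :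
    ∃ i l k t, i + l + k = n ∧ 1 ≤ l ∧ l ≤ Fintype.card S * F ∧ F ∣ l ∧
      tropPow M i s t + tropPow M l t t + tropPow M k t r ≤ tropPow M n s r := by
  obtain ⟨f, rfl, rfl, hf⟩ := exists_path M n s r h
  have key : ∃ i j, i < j ∧ j ≤ Fintype.card S * F ∧ f i = f j ∧ i % F = j % F := by
    obtain ⟨i, hi, j, hj, hij, he⟩ := Finset.exists_ne_map_eq_of_card_lt_of_maps_to
      (s := Finset.range (Fintype.card S * F + 1))
      (t := (Finset.univ : Finset S) ×ˢ Finset.range F) (f := fun i => (f i, i % F))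
      (by simp) (by intro i _; simp [Nat.mod_lt _ hF])
    simp only [Prod.mk.injEq, Finset.mem_range] at he hi hj
    rcases lt_or_gt_of_ne hij with h | h
    · exact ⟨i, j, h, by omega, he.1, he.2⟩
    · exact ⟨j, i, h, by omega, he.1.symm, he.2.symm⟩
  obtain ⟨i, j, hij, hj, he, hmod⟩ := key
  refine ⟨i, j - i, n - j, f i, by omega, by omega, by omega,
    (Nat.modEq_iff_dvd' hij.le).mp hmod, ?_⟩
  have h1 := tropPow_le_sum M f 0 i
  have h2 := tropPow_le_sum M f i (j - i)
  have h3 := tropPow_le_sum M f j (n - j)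
  rw [Nat.add_sub_cancel' hij.le, ← he] at h2
  rw [Nat.add_sub_cancel' (by omega), ← he] at h3
  rw [zero_add] at h1
  rw [hf, Finset.range_eq_Ico, ← Finset.sum_Ico_consecutive _ (Nat.zero_le j) (hj.trans hn),
    ← Finset.sum_Ico_consecutive _ (Nat.zero_le i) hij.le]
  exact add_le_add (add_le_add h1 h2) h3

/-- If no cycle has negative weight, then a path whose length is a multiple of `F` can be shortened
to length at most `|S| * F` by removing cycles whose length is a multiple of `F`. -/
theorem exists_tropPow_le_of_dvd {M : Weights S} (hM : ∀ n t, 0 ≤ tropPow M n t t) {F : ℕ}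
    (hF : 0 < F) (s r : S) (n : ℕ) (hn : F ∣ n) :
    ∃ n' ≤ Fintype.card S * F, F ∣ n' ∧ tropPow M n' s r ≤ tropPow M n s r := by
  induction n using Nat.strong_induction_on with
  | _ n ih =>
    by_cases hle : n ≤ Fintype.card S * F
    · exact ⟨n, hle, hn, le_rfl⟩
    by_cases htop : tropPow M n s r = ⊤
    · exact ⟨0, Nat.zero_le _, dvd_zero _, by simp [htop]⟩
    obtain ⟨i, l, k, t, rfl, hl, -, hFl, hle'⟩ := exists_cycle M hF (by omega) htop
    obtain ⟨n', h1, h2, h3⟩ := ih (i + k) (by omega) (by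
      have : i + k = i + l + k - l := by omega
      rw [this]
      exact Nat.dvd_sub hn hFl)
    refine ⟨n', h1, h2, h3.trans (le_trans ?_ hle')⟩
    refine (tropPow_add_le M i k s t r).trans ?_
    gcongr
    exact le_add_of_nonneg_right (hM l t)

theorem tropPow_le_to_zeroCycle {M : Weights S} (hM : ∀ n t, 0 ≤ tropPow M n t t) {F : ℕ}
    (hF : 0 < F) {g : S} (hg : tropPow M F g g ≤ 0) (s : S) {n : ℕ} (hn : F ∣ n) :
    tropPow M (Fintype.card S * F) s g ≤ tropPow M n s g := by
  obtain ⟨n', h1, ⟨c, rfl⟩, h3⟩ := exists_tropPow_le_of_dvd hM hF s g n hn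
  have hc : c ≤ Fintype.card S := Nat.le_of_mul_le_mul_left (by linarith) hF
  obtain ⟨e, he⟩ := Nat.exists_eq_add_of_le hc
  rw [he, add_mul, mul_comm c, mul_comm e]
  refine (tropPow_add_le M _ _ s g g).trans (le_trans ?_ h3)
  simpa using add_le_add_right (tropPow_mul_self_le_zero hg e) (tropPow M (F * c) s g)

theorem tropPow_le_from_zeroCycle {M : Weights S} (hM : ∀ n t, 0 ≤ tropPow M n t t) {F : ℕ}
    (hF : 0 < F) {g : S} (hg : tropPow M F g g ≤ 0) (r : S) {n : ℕ} (hn : F ∣ n) :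
    tropPow M (Fintype.card S * F) g r ≤ tropPow M n g r := by
  obtain ⟨n', h1, ⟨c, rfl⟩, h3⟩ := exists_tropPow_le_of_dvd hM hF g r n hn
  have hc : c ≤ Fintype.card S := Nat.le_of_mul_le_mul_left (by linarith) hF
  obtain ⟨e, he⟩ := Nat.exists_eq_add_of_le hc
  rw [he, add_comm c, add_mul, mul_comm c, mul_comm e]
  refine (tropPow_add_le M _ _ g g r).trans (le_trans ?_ h3)
  simpa using add_le_add_left (tropPow_mul_self_le_zero hg e) (tropPow M (F * c) g r)

theorem tropPow_lower_bound {M : Weights S} {μ : ℕ}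
    (hμ : ∀ s t, ((-(μ : ℤ) : ℤ) : WithTop ℤ) ≤ M s t) (n : ℕ) (s r : S) :
    ((-((n * μ : ℕ) : ℤ) : ℤ) : WithTop ℤ) ≤ tropPow M n s r := by
  induction n generalizing s with
  | zero =>
    simp only [tropPow, mwt, List.replicate_zero]
    split_ifs <;> simp
  | succ n ih =>
    obtain ⟨t, ht⟩ := exists_tropPow_succ M n s r
    rw [ht]
    refine le_trans ?_ (add_le_add (hμ s t) (ih t))
    rw [← WithTop.coe_add]
    refine WithTop.coe_le_coe.mpr (le_of_eq ?_)
    push_cast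
    ring

/-- If all short cycles have positive weight, then the weights of paths grow linearly with their
length. -/
theorem linear_growth (M : Weights S)
    (hpos : ∀ l t, 1 ≤ l → l ≤ Fintype.card S → 1 ≤ tropPow M l t t) :
    ∃ K : ℕ, ∀ (n : ℕ) (s r : S) (v : ℤ), tropPow M n s r = v →
      (n : ℤ) ≤ K + Fintype.card S * v := by
  obtain ⟨μ, hμ⟩ := exists_lower_bound M
  set C := Fintype.card S with hC
  refine ⟨C * (C * μ) + C, fun n => ?_⟩
  induction n using Nat.strong_induction_on with
  | _ n ih =>
    intro s r v hv
    by_cases hn : n < C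
    · have h1 := tropPow_lower_bound hμ n s r
      rw [hv, WithTop.coe_le_coe] at h1
      have h2 : n * μ ≤ C * μ := Nat.mul_le_mul_right _ hn.le
      have h3 : -((C * μ : ℕ) : ℤ) ≤ v := by omega
      have h4 : (C : ℤ) * -((C * μ : ℕ) : ℤ) ≤ C * v := mul_le_mul_of_nonneg_left h3 (by positivity)
      push_cast at h4 ⊢
      have : (n : ℤ) ≤ C := by exact_mod_cast hn.le
      linarith
    · obtain ⟨i, l, k, t, rfl, hl, hlC, -, hle⟩ := exists_cycle M (F := 1) (n := n) (s := s) (r := r)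
        one_pos (by omega) (by simp [hv])
      rw [mul_one] at hlC
      have h1 := hpos l t hl hlC
      have h2 := tropPow_add_le M i k s t r
      rw [hv] at hle
      cases ha : tropPow M i s t with
      | top => simp [ha] at hle
      | coe a =>
      cases hb : tropPow M l t t with
      | top => simp [hb] at hle
      | coe b =>
      cases hc : tropPow M k t r with
      | top => simp [hc] at hle
      | coe c =>
      rw [ha, hb, hc] at hle
      rw [ha, hc] at h2
      cases he : tropPow M (i + k) s r with
      | top => rw [he, top_le_iff] at h2; simp [← WithTop.coe_add] at h2
      | coe e =>
      have h3 := ih (i + k) (by omega) s r e he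
      rw [he, ← WithTop.coe_add, WithTop.coe_le_coe] at h2
      rw [← WithTop.coe_add, ← WithTop.coe_add, WithTop.coe_le_coe] at hle
      rw [hb] at h1
      have h1' : (1 : ℤ) ≤ b := by exact_mod_cast h1
      have h5 : (C : ℤ) * (e + 1) ≤ C * v := mul_le_mul_of_nonneg_left (by linarith) (by positivity)
      have h6 : (l : ℤ) ≤ C := by exact_mod_cast hlC
      push_cast at h3 ⊢
      linarith

/-- A path either passes through `Z`, or it survives when the transitions out of `Z` are
removed. -/
theorem exists_visit_or_le (M : Weights S) (Z : Set S) [DecidablePred (· ∈ Z)] (n : ℕ) (s r : S) :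
    (∃ i k, ∃ t ∈ Z, i + k = n ∧ tropPow M i s t + tropPow M k t r ≤ tropPow M n s r) ∨
      tropPow (fun a b => if a ∈ Z then ⊤ else M a b) n s r ≤ tropPow M n s r := by
  induction n generalizing s with
  | zero => exact Or.inr le_rfl
  | succ n ih =>
    by_cases hs : s ∈ Z
    · exact Or.inl ⟨0, n + 1, s, hs, by omega, by simp [tropPow_zero_self]⟩
    obtain ⟨t, ht⟩ := exists_tropPow_succ M n s r
    rcases ih t with ⟨i, k, z, hz, hik, hle⟩ | hle
    · refine Or.inl ⟨i + 1, k, z, hz, by omega, ?_⟩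
      rw [ht]
      calc tropPow M (i + 1) s z + tropPow M k z r
          ≤ M s t + tropPow M i t z + tropPow M k z r := by
            gcongr
            exact mwt_cons_le M _ s t z
        _ ≤ _ := by rw [add_assoc]; gcongr
    · refine Or.inr ?_
      rw [ht]
      refine (mwt_cons_le _ _ s t r).trans ?_
      simp only [hs, if_false]
      gcongr
      exact hle

/-- The stabilisation of a table without negative cycles. In a suitable large power, every entry
below the bound `N` is at least the weight of a detour `s → g → r` in two `m`-th powers (`m` is
`stabConst`) through a vertex `g` on a cycle of weight `0`; and each of these detours is an upper
bound for the entry. -/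
theorem exists_stabilising_power {M : Weights S} (hM : ∀ n t, 0 ≤ tropPow M n t t) (N : ℤ) :
    ∃ n : ℕ, ∀ s r,
      (tropPow M n s r < N → ∃ g, tropPow M (stabConst S) g g ≤ 0 ∧
        tropPow M (stabConst S) s g + tropPow M (stabConst S) g r ≤ tropPow M n s r) ∧
      ∀ g, tropPow M (stabConst S) g g ≤ 0 →
        tropPow M n s r ≤ tropPow M (stabConst S) s g + tropPow M (stabConst S) g r := by
  classical
  set C := Fintype.card S with hC
  set F := C.factorial with hF
  have hFpos : 0 < F := Nat.factorial_pos _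
  have hm : stabConst S = C * F := rfl
  let Z : Set S := {t | tropPow M F t t ≤ 0}
  let M' : Weights S := fun a b => if a ∈ Z then ⊤ else M a b
  have hle : ∀ a b, M a b ≤ M' a b := by
    intro a b
    simp only [M']
    split_ifs <;> simp
  obtain ⟨K, hK⟩ := linear_growth M' (by
    intro l t hl hlC
    by_contra hlt
    rw [not_le] at hlt
    by_cases ht : t ∈ Z
    · obtain ⟨l, rfl⟩ := Nat.exists_eq_add_of_le' hl
      obtain ⟨z, hz⟩ := exists_tropPow_succ M' l t t
      simp [hz, M', ht] at hlt
    · apply ht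
      obtain ⟨e, he⟩ : l ∣ F := Nat.dvd_factorial hl hlC
      have h0 : tropPow M l t t ≤ 0 := by
        have h1 := (tropPow_mono hle l t t).trans_lt hlt
        cases hv : tropPow M l t t with
        | top => simp [hv] at h1
        | coe v =>
          rw [hv] at h1
          have : v < 1 := by exact_mod_cast h1
          exact_mod_cast (by omega : v ≤ 0)
      change tropPow M F t t ≤ 0
      rw [he]
      exact tropPow_mul_self_le_zero h0 e)
  refine ⟨stabConst S * (K + C * N.natAbs + 2), fun s r => ⟨fun hlt => ?_, fun g hg => ?_⟩⟩
  · have hCpos : 0 < C := Fintype.card_pos_iff.mpr ⟨s⟩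
    have hmpos : 0 < stabConst S := hm ▸ Nat.mul_pos hCpos hFpos
    set n := stabConst S * (K + C * N.natAbs + 2) with hn
    rcases exists_visit_or_le M Z n s r with ⟨i, k, t, ht, hik, hsum⟩ | hle'
    · -- The path meets a cycle of weight `0` at `t`. Moving `a` steps along this cycle leads to a
      -- vertex `g` at a time divisible by `F`.
      set a := F - i % F with ha
      have hmod := Nat.mod_lt i hFpos
      obtain ⟨g, hg⟩ := exists_tropPow_add M a (F - a) t t
      rw [show a + (F - a) = F by omega] at hg
      have hgZ : tropPow M F g g ≤ 0 := by
        have h1 := tropPow_add_le M (F - a) a g t g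
        rw [show F - a + a = F by omega, add_comm, ← hg] at h1
        exact h1.trans ht
      have hd1 : F ∣ i + a := by
        have : i + a = F * (i / F) + F := by have := Nat.div_add_mod i F; omega
        rw [this]
        exact Dvd.dvd.add (dvd_mul_right _ _) dvd_rfl
      have hd2 : F ∣ F - a + k := by
        have h1 : F ∣ (i + a) + (F - a + k) := by
          rw [show (i + a) + (F - a + k) = n + F by omega, hn, hm]
          exact Dvd.dvd.add (((dvd_mul_left F C)).mul_right _) dvd_rfl
        exact (Nat.dvd_add_right hd1).mp h1
      have h1 := tropPow_le_to_zeroCycle hM hFpos hgZ s hd1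
      have h2 := tropPow_le_from_zeroCycle hM hFpos hgZ r hd2
      refine ⟨g, ?_, ?_⟩
      · rw [hm, mul_comm]
        exact tropPow_mul_self_le_zero hgZ C
      · calc _ ≤ tropPow M (i + a) s g + tropPow M (F - a + k) g r := add_le_add h1 h2
          _ ≤ (tropPow M i s t + tropPow M a t g) + (tropPow M (F - a) g t + tropPow M k t r) :=
            add_le_add (tropPow_add_le M _ _ _ _ _) (tropPow_add_le M _ _ _ _ _)
          _ = (tropPow M i s t + tropPow M k t r) + (tropPow M a t g + tropPow M (F - a) g t) := by
            abel
          _ = (tropPow M i s t + tropPow M k t r) + tropPow M F t t := by rw [hg]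
          _ ≤ tropPow M n s r + 0 := add_le_add hsum ht
          _ = _ := add_zero _
    · exfalso
      have hlt' := hle'.trans_lt hlt
      cases hv : tropPow (fun a b => if a ∈ Z then ⊤ else M a b) n s r with
      | top => simp [hv] at hlt'
      | coe v =>
        have h1 := hK n s r v hv
        rw [hv, WithTop.coe_lt_coe] at hlt'
        have h2 : (C : ℤ) * v ≤ C * N.natAbs := mul_le_mul_of_nonneg_left (by omega) (by positivity)
        have h3 : K + C * N.natAbs + 2 ≤ n := Nat.le_mul_of_pos_left _ hmpos
        have h4 : ((K + C * N.natAbs + 2 : ℕ) : ℤ) ≤ n := by exact_mod_cast h3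
        push_cast at h4 h2
        rw [← hC] at h1
        linarith
  · set m := stabConst S
    rw [show m * (K + C * N.natAbs + 2) = m + (m * (K + C * N.natAbs) + m) by ring]
    refine (tropPow_add_le M _ _ s g r).trans ?_
    gcongr
    refine (tropPow_add_le M _ _ g g r).trans ?_
    simpa using add_le_add_left (tropPow_mul_self_le_zero hg (K + C * N.natAbs)) (tropPow M m g r)

end Tropical

/-! ### Approximation of tables -/

/-- The value `a` agrees with `b` up to the threshold `N`: it is `b` if `b` is finite, and at least
`N` if `b = ⊤`. -/
def Approx (N : ℤ) (a b : WithTop ℤ) : Prop := a = b ∨ b = ⊤ ∧ (N : WithTop ℤ) ≤ a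

theorem Approx.trans {N : ℤ} {a b c : WithTop ℤ} (h₁ : Approx N a b) (h₂ : Approx N b c) :
    Approx N a c := by
  rcases h₁ with rfl | ⟨rfl, h₁⟩
  · exact h₂
  · rcases h₂ with rfl | ⟨rfl, -⟩ <;> exact Or.inr ⟨rfl, h₁⟩

theorem Approx.add {N N' : ℤ} {μ : ℕ} {a a' b b' : WithTop ℤ} (ha : Approx N' a' a)
    (hb : a' ≠ ⊤ → Approx N' b' b) (hμa : ((-(μ : ℤ) : ℤ) : WithTop ℤ) ≤ a)
    (hμb : ((-(μ : ℤ) : ℤ) : WithTop ℤ) ≤ b) (hN : N + μ ≤ N') (hN' : 0 ≤ N') :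
    Approx N (a' + b') (a + b) := by
  rcases ha with rfl | ⟨rfl, ha⟩
  · by_cases h : a' = ⊤
    · exact Or.inl (by simp [h])
    · rcases hb h with rfl | ⟨rfl, hb₀⟩
      · exact Or.inl rfl
      · refine Or.inr ⟨by simp, le_trans ?_ (add_le_add hμa hb₀)⟩
        rw [← WithTop.coe_add]
        exact WithTop.coe_le_coe.mpr (by omega)
  · by_cases h : a' = ⊤
    · exact Or.inl (by simp [h])
    · refine Or.inr ⟨by simp, ?_⟩
      have h1 : ((-(μ : ℤ) : ℤ) : WithTop ℤ) ≤ b' := by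
        rcases hb h with rfl | ⟨-, hb⟩
        · exact hμb
        · exact le_trans (WithTop.coe_le_coe.mpr (by omega)) hb
      refine le_trans ?_ (add_le_add ha h1)
      rw [← WithTop.coe_add]
      exact WithTop.coe_le_coe.mpr (by omega)

section Composition

variable {S : Type*} [Fintype S] [DecidableEq S]

/-- Approximation is compatible with concatenation, if the thresholds of the two factors are large
enough in terms of the factors that are approximated. -/
theorem exists_approx_append (x y : List (Weights S)) (N : ℤ) :
    ∃ N' : ℤ, ∀ (x' y' : List (Weights S)) (s : S),
      (∀ t, Approx N' (mwt x' s t) (mwt x s t)) →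
      (∀ t, mwt x' s t ≠ ⊤ → ∀ r, Approx N' (mwt y' t r) (mwt y t r)) →
      ∀ r, Approx N (mwt (x' ++ y') s r) (mwt (x ++ y) s r) := by
  obtain ⟨μ₁, h₁⟩ := exists_lower_bound (mwt x)
  obtain ⟨μ₂, h₂⟩ := exists_lower_bound (mwt y)
  obtain ⟨ν, hν⟩ := exists_abs_bound (mwt (x ++ y))
  refine ⟨|N| + ν + (μ₁ + μ₂ : ℕ), fun x' y' s hx hy r => ?_⟩
  have key : ∀ t, Approx (|N| + ν) (mwt x' s t + mwt y' t r) (mwt x s t + mwt y t r) := fun t =>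
    Approx.add (hx t) (fun h => hy t h r)
      ((WithTop.coe_le_coe.mpr (by push_cast; omega)).trans (h₁ s t))
      ((WithTop.coe_le_coe.mpr (by push_cast; omega)).trans (h₂ t r)) le_rfl (by positivity)
  obtain ⟨t, ht⟩ := exists_mwt_append x' y' s r
  obtain ⟨t', ht'⟩ := exists_mwt_append x y s r
  have hN : (N : WithTop ℤ) ≤ ((|N| + ν : ℤ) : WithTop ℤ) :=
    WithTop.coe_le_coe.mpr (by have := le_abs_self N; omega)
  have hle : mwt (x ++ y) s r ≤ mwt x s t + mwt y t r := mwt_append_le _ _ _ _ _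
  cases hv : mwt (x ++ y) s r with
  | top =>
    rw [hv, top_le_iff] at hle
    rcases key t with h | ⟨-, h⟩
    · exact Or.inl (by rw [ht, h, hle])
    · exact Or.inr ⟨rfl, ht ▸ hN.trans h⟩
  | coe v =>
    left
    rw [← hv]
    apply le_antisymm
    · rcases key t' with h | ⟨h, -⟩
      · rw [ht', ← h]
        exact mwt_append_le _ _ _ _ _
      · rw [← ht', hv] at h
        simp at h
    · rcases key t with h | ⟨-, h⟩
      · rw [ht, h]
        exact hle
      · rw [ht, hv]
        refine le_trans (WithTop.coe_le_coe.mpr ?_) h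
        have := le_abs_self v
        have := hν s r v hv
        have := abs_nonneg N
        omega

end Composition

/-! ### Stable cycles -/

theorem stabConst_pos {S : Type*} [Fintype S] (s : S) : 0 < stabConst S :=
  Nat.mul_pos (Fintype.card_pos_iff.mpr ⟨s⟩) (Nat.factorial_pos _)

section Stabilisation

variable {S : Type*} [Fintype S] [DecidableEq S]

theorem stabWeight_le {S' : Finset S} {x : List (Weights S)} {s r g : S} (hs : s ∈ S')
    (hr : r ∈ S') (hg : IsMinState S' (wordPow x (stabConst S)) g) :
    stabWeight S' x s r ≤
      mwt (wordPow x (stabConst S)) s g + mwt (wordPow x (stabConst S)) g r := by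
  classical
  by_cases h1 : mwt (wordPow x (stabConst S)) s g = ⊤
  · simp [h1]
  by_cases h2 : mwt (wordPow x (stabConst S)) g r = ⊤
  · simp [h2]
  rw [stabWeight, if_pos ⟨hs, hr, g, hg, h1, h2⟩]
  refine (Finset.inf_le (Finset.mem_univ g)).trans ?_
  rw [if_pos hg]

theorem exists_stabWeight_eq {S' : Finset S} {x : List (Weights S)} {s r : S}
    (h : stabWeight S' x s r ≠ ⊤) :
    s ∈ S' ∧ r ∈ S' ∧ ∃ g, IsMinState S' (wordPow x (stabConst S)) g ∧
      stabWeight S' x s r =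
        mwt (wordPow x (stabConst S)) s g + mwt (wordPow x (stabConst S)) g r := by
  classical
  have hG : IsGrnPair S' x s r := by
    by_contra hG
    exact h (by rw [stabWeight, if_neg hG])
  obtain ⟨g, -, hg⟩ := Finset.exists_mem_eq_inf (Finset.univ : Finset S) ⟨s, Finset.mem_univ s⟩
    (fun g => if IsMinState S' (wordPow x (stabConst S)) g then
        mwt (wordPow x (stabConst S)) s g + mwt (wordPow x (stabConst S)) g r else ⊤)
  have he := hg
  rw [show Finset.univ.inf _ = stabWeight S' x s r from (if_pos hG).symm] at he
  by_cases hm : IsMinState S' (wordPow x (stabConst S)) g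
  · rw [if_pos hm] at he
    exact ⟨hG.1, hG.2.1, g, hm, he⟩
  · rw [if_neg hm] at he
    exact absurd he h

/-- Paths out of `S'` stay in `S'` if all transitions out of `S'` lead to `S'`, so that they are not
affected when all other transitions are removed. -/
theorem tropPow_restrict {S' : Finset S} {M : Weights S}
    (hcl : ∀ t ∈ S', ∀ r, M t r ≠ ⊤ → r ∈ S') (n : ℕ) {s : S} (hs : s ∈ S') (r : S) :
    tropPow (fun a b => if a ∈ S' then M a b else ⊤) n s r = tropPow M n s r ∧
      (tropPow M n s r ≠ ⊤ → r ∈ S') := by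
  induction n generalizing s with
  | zero =>
    refine ⟨rfl, fun h => ?_⟩
    by_cases hsr : s = r
    · exact hsr ▸ hs
    · simp [tropPow, mwt, hsr] at h
  | succ n ih =>
    constructor
    · simp only [tropPow, List.replicate_succ, mwt, if_pos hs] at ih ⊢
      refine Finset.inf_congr rfl fun t _ => ?_
      by_cases ht : M s t = ⊤
      · simp [ht]
      · rw [(ih (hcl s hs t ht)).1]
    · intro h
      obtain ⟨t, ht⟩ := exists_tropPow_succ M n s r
      rw [ht] at h
      exact (ih (hcl s hs t fun h0 => h (by simp [h0]))).2 fun h0 => h (by simp [h0])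

end Stabilisation

/-- A suitable power of the word of a stable cycle approximates the cactus letter. -/
theorem IsStableCycle.exists_approx {Q : Type*} [Fintype Q] [DecidableEq Q]
    {S' : Finset (BState Q)} {x : List (Weights (BState Q))} (h : IsStableCycle S' x) (N : ℤ) :
    ∃ n : ℕ, ∀ s ∈ S', ∀ r, Approx N (mwt (wordPow x n) s r) (stabWeight S' x s r) := by
  obtain ⟨s₀, -, -, hcl, hmin⟩ := h
  set m := stabConst (BState Q) with hm
  have hmpos : 0 < m := stabConst_pos s₀
  let M : Weights (BState Q) := fun a b => if a ∈ S' then mwt x a b else ⊤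
  have hMx : ∀ n, ∀ s ∈ S', ∀ r, tropPow M n s r = mwt (wordPow x n) s r := by
    intro n s hs r
    rw [mwt_wordPow]
    exact (tropPow_restrict hcl n hs r).1
  have hmem : ∀ n, ∀ s ∈ S', ∀ r, mwt (wordPow x n) s r ≠ ⊤ → r ∈ S' := by
    intro n s hs r
    rw [mwt_wordPow]
    exact (tropPow_restrict hcl n hs r).2
  have hout : ∀ n, 0 < n → ∀ s ∉ S', ∀ r, tropPow M n s r = ⊤ := by
    intro n hn s hs r
    obtain ⟨n, rfl⟩ := Nat.exists_eq_add_of_le' hn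
    obtain ⟨t, ht⟩ := exists_tropPow_succ M n s r
    simp [ht, M, hs]
  have hnn : ∀ n, ∀ s ∈ S', 0 ≤ mwt (wordPow x n) s s := by
    intro n s hs
    by_cases htop : mwt (wordPow x n) s s = ⊤
    · simp [htop]
    · rw [← (hmin n).2]
      exact (hmin n).1.2 s ⟨hs, htop⟩
  have hM : ∀ n t, 0 ≤ tropPow M n t t := by
    intro n t
    by_cases ht : t ∈ S'
    · rw [hMx n t ht]
      exact hnn n t ht
    · rcases Nat.eq_zero_or_pos n with rfl | hn
      · rw [tropPow_zero_self]
      · simp [hout n hn t ht]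
  have hminst : ∀ g, IsMinState S' (wordPow x m) g ↔ tropPow M m g g ≤ 0 := by
    intro g
    constructor
    · intro hg
      rw [hMx m g hg.1.1, ← (hmin m).2]
      exact hg.2 s₀ (hmin m).1.1
    · intro hg
      have hgS : g ∈ S' := by
        by_contra hgS
        simp [hout m hmpos g hgS] at hg
      rw [hMx m g hgS] at hg
      exact ⟨⟨hgS, fun h0 => by simp [h0] at hg⟩, fun r hr => hg.trans (hnn m r hr.1)⟩
  obtain ⟨ν, hν⟩ := exists_abs_bound (stabWeight S' x)
  obtain ⟨n, hn⟩ := exists_stabilising_power hM (|N| + ν + 1)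
  refine ⟨n, fun s hs r => ?_⟩
  obtain ⟨h1, h2⟩ := hn s r
  rw [hMx n s hs r] at h1 h2
  have hup : mwt (wordPow x n) s r ≤ stabWeight S' x s r := by
    by_cases htop : stabWeight S' x s r = ⊤
    · simp [htop]
    obtain ⟨-, hr, g, hg, he⟩ := exists_stabWeight_eq htop
    rw [he, ← hMx m s hs g, ← hMx m g hg.1.1 r]
    exact h2 g ((hminst g).mp hg)
  by_cases hlt : mwt (wordPow x n) s r < ((|N| + ν + 1 : ℤ) : WithTop ℤ)
  · left
    obtain ⟨g, hg, hle⟩ := h1 hlt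
    have hgm := (hminst g).mpr hg
    rw [hMx m s hs g, hMx m g hgm.1.1 r] at hle
    exact le_antisymm hup
      ((stabWeight_le hs (hmem n s hs r (ne_top_of_lt hlt)) hgm).trans hle)
  · rw [not_lt] at hlt
    right
    constructor
    · by_contra htop
      obtain ⟨v, hv⟩ := WithTop.ne_top_iff_exists.mp htop
      have h3 := hν s r v hv.symm
      have h4 := hlt.trans hup
      rw [← hv, WithTop.coe_le_coe] at h4
      have := le_abs_self v
      have := abs_nonneg N
      omega
    · refine le_trans (WithTop.coe_le_coe.mpr ?_) hlt
      have := le_abs_self N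
      omega

/-! ### Unfolding cactus letters -/

namespace BState

theorem mem_fiber {Q : Type*} [Fintype Q] [DecidableEq Q] {s t : BState Q} :
    t ∈ s.fiber ↔ t.base = s.base ∧ t.reach = s.reach := by
  simp [fiber]

theorem fiber_eq_of_mem {Q : Type*} [Fintype Q] [DecidableEq Q] {s t : BState Q}
    (h : t ∈ s.fiber) : t.fiber = s.fiber := by
  rw [mem_fiber] at h
  simp only [fiber, h.1, h.2]

end BState

namespace WFA

variable {Q Λ : Type*} [Fintype Q] [DecidableEq Q]

theorem letterWeight_cactus (A : WFA Q Λ) (S' : Finset (BState Q)) (w : List (Letter Q Λ)) :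
    A.letterWeight (.cactus S' w) = stabWeight S' (A.tables w) := by
  rw [letterWeight, tables]

theorem tables_append (A : WFA Q Λ) (w w' : List (Letter Q Λ)) :
    A.tables (w ++ w') = A.tables w ++ A.tables w' := List.map_append

theorem tables_wordPow (A : WFA Q Λ) (w : List (Letter Q Λ)) (n : ℕ) :
    A.tables (wordPow w n) = wordPow (A.tables w) n := by
  simp [tables, wordPow, List.map_flatten]

theorem trnWeight_ne_top {A : WFA Q Λ} {p q : Q} {σ : Λ} {s t : BState Q}
    (h : A.trnWeight p σ q s t ≠ ⊤) :
    A.wt p σ q ≠ ⊤ ∧ s.base = p ∧ t.base = q ∧ t.reach = A.succ s.reach σ := by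
  by_contra h'
  exact h (if_neg h')

/-- A letter of the base alphabet determines the fiber in which its transitions out of a given
fiber end. -/
theorem mem_fiber_of_isTrn {A : WFA Q Λ} {a : Letter Q Λ} (ha : a.IsTrn) {s t s' t' : BState Q}
    (hs : s' ∈ s.fiber) (h : A.letterWeight a s t ≠ ⊤) (h' : A.letterWeight a s' t' ≠ ⊤) :
    t' ∈ t.fiber := by
  cases a with
  | trn p σ q =>
    rw [letterWeight] at h h'
    have h1 := trnWeight_ne_top h
    have h2 := trnWeight_ne_top h'
    rw [BState.mem_fiber] at hs ⊢
    exact ⟨h2.2.2.1.trans h1.2.2.1.symm, by rw [h2.2.2.2, h1.2.2.2, hs.2]⟩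
  | _ => exact ha.elim

theorem mem_fiber_of_forall_isTrn {A : WFA Q Λ} {w : List (Letter Q Λ)}
    (hw : ∀ a ∈ w, a.IsTrn) {s t s' t' : BState Q} (hs : s' ∈ s.fiber)
    (h : mwt (A.tables w) s t ≠ ⊤) (h' : mwt (A.tables w) s' t' ≠ ⊤) : t' ∈ t.fiber := by
  induction w generalizing s s' with
  | nil =>
    have h1 : s = t := by by_contra h0; simp [tables, mwt, h0] at h
    have h2 : s' = t' := by by_contra h0; simp [tables, mwt, h0] at h'
    exact h1 ▸ h2 ▸ hs
  | cons a w ih =>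
    obtain ⟨r, hr⟩ := exists_mwt_cons (A.letterWeight a) (A.tables w) s t
    obtain ⟨r', hr'⟩ := exists_mwt_cons (A.letterWeight a) (A.tables w) s' t'
    simp only [tables, List.map_cons] at h h' hr hr' ih
    rw [hr, WithTop.add_ne_top] at h
    rw [hr', WithTop.add_ne_top] at h'
    exact ih (fun c hc => hw c (List.mem_cons_of_mem _ hc))
      (mem_fiber_of_isTrn (hw a List.mem_cons_self) hs h.1 h'.1) h.2 h'.2

/-- For every threshold and every fiber from which the table `M` has a transition, there is a word
over the base alphabet which approximates `M` on this fiber. -/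
def IsUnfoldable (A : WFA Q Λ) (M : Weights (BState Q)) : Prop :=
  ∀ s t, M s t ≠ ⊤ → ∀ N : ℤ, ∃ w : List (Letter Q Λ), (∀ a ∈ w, a.IsTrn) ∧
    ∀ s' ∈ s.fiber, ∀ r, Approx N (mwt (A.tables w) s' r) (M s' r)

theorem isUnfoldable_mwt {A : WFA Q Λ} {w : List (Letter Q Λ)}
    (hw : ∀ a ∈ w, A.IsUnfoldable (A.letterWeight a)) : A.IsUnfoldable (mwt (A.tables w)) := by
  induction w with
  | nil => exact fun s t _ N => ⟨[], by simp, fun _ _ _ => Or.inl rfl⟩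
  | cons a w ih =>
    intro s t hst N
    have hcons : A.tables (a :: w) = [A.letterWeight a] ++ A.tables w := rfl
    rw [hcons] at hst ⊢
    obtain ⟨N', hN'⟩ := exists_approx_append [A.letterWeight a] (A.tables w) N
    obtain ⟨r, hr⟩ := exists_mwt_append [A.letterWeight a] (A.tables w) s t
    rw [hr, mwt_singleton, WithTop.add_ne_top] at hst
    obtain ⟨h1, h2⟩ := hst
    obtain ⟨x, hx, hxa⟩ := hw a List.mem_cons_self s r h1 N'
    obtain ⟨y, hy, hya⟩ := ih (fun c hc => hw c (List.mem_cons_of_mem _ hc)) r t h2 N'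
    have hsr : mwt (A.tables x) s r ≠ ⊤ := by
      rcases hxa s (BState.mem_fiber.mpr ⟨rfl, rfl⟩) r with h | h
      · rwa [h]
      · exact absurd h.1 h1
    refine ⟨x ++ y, by simpa [or_imp, forall_and] using ⟨hx, hy⟩, fun s' hs' => ?_⟩
    rw [tables_append]
    refine hN' _ _ s' (by simpa [mwt_singleton] using hxa s' hs') fun t' ht' => ?_
    exact hya t' (mem_fiber_of_forall_isTrn hx hs' hsr ht')

/-- Every cactus letter can be unfolded: it is approximated by a power of its word, the letters of
which are unfolded in turn. -/
theorem BoundedCac.isUnfoldable {A : WFA Q Λ} {L : ℕ → ℕ} {a : Letter Q Λ}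
    (ha : A.BoundedCac L a) : A.IsUnfoldable (A.letterWeight a) := by
  induction ha with
  | trn p σ q =>
    intro s t _ N
    refine ⟨[.trn p σ q], by simp [Letter.IsTrn], fun s' _ r => Or.inl ?_⟩
    simp [tables, mwt_singleton]
  | cactus S' w hw hstable _ _ _ ih =>
    intro s t hst N
    rw [letterWeight_cactus] at hst ⊢
    obtain ⟨n, hn⟩ := hstable.exists_approx N
    obtain ⟨s₀, -, hS', -, hmin⟩ := hstable
    have hs : s.fiber = S' := by
      rw [hS']
      exact BState.fiber_eq_of_mem (hS' ▸ (exists_stabWeight_eq hst).1)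
    have hs₀ : s₀.fiber = S' := hS'.symm
    have hU : A.IsUnfoldable (mwt (A.tables (wordPow w n))) :=
      isUnfoldable_mwt fun a ha => ih a (mem_of_mem_wordPow ha)
    obtain ⟨x, hx, hxa⟩ := hU s₀ s₀ (by simp [tables_wordPow, (hmin n).2]) N
    refine ⟨x, hx, fun s' hs' r => ?_⟩
    rw [hs] at hs'
    have h1 := hxa s' (hs₀ ▸ hs') r
    rw [tables_wordPow] at h1
    exact h1.trans (hn s' hs' r)

end WFA

/-! ### Weights of bounded cactus letters -/

namespace BoundParams

variable {B : BoundParams}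

theorem len_succ {d i : ℕ} (hi : i ≤ B.n) :
    B.len (d + 1) i = 32 * B.m ^ 2 * B.len d 1 * B.len (d + 1) (i + 1) *
      (ramsey (B.types (d + 1) i) 3 + 2) ^ (2 * B.amp (d + 1) i + 1) := by
  rw [len, if_neg (by omega)]

theorem len_succ_of_lt {d i : ℕ} (hi : B.n < i) : B.len (d + 1) i = B.b := by
  rw [len, if_pos hi]

theorem len_succ_eq_zero (hb : B.b = 0) (d i : ℕ) : B.len (d + 1) i = 0 := by
  induction h : B.n + 1 - i generalizing i with
  | zero => rw [len_succ_of_lt (by omega), hb]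
  | succ k ih => rw [len_succ (by omega), ih (i + 1) (by omega)]; simp

theorem len_pos (hb : 0 < B.b) (hm : 0 < B.m) (d i : ℕ) : 0 < B.len d i := by
  induction d generalizing i with
  | zero => rw [len]; exact one_pos
  | succ d ihd =>
    induction h : B.n + 1 - i generalizing i with
    | zero => rw [len_succ_of_lt (by omega)]; exact hb
    | succ k ih =>
      rw [len_succ (by omega)]
      have := ih (i + 1) (by omega)
      have := ihd 1
      positivity

theorem len_succ_one_le_len_succ_zero (hm : 0 < B.m) (d : ℕ) :
    B.len (d + 1) 1 ≤ B.len (d + 1) 0 := by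
  rcases Nat.eq_zero_or_pos B.b with hb | hb
  · simp [len_succ_eq_zero hb]
  · have := len_pos hb hm d 1
    rw [len_succ (i := 0) (by omega), mul_right_comm]
    exact Nat.le_mul_of_pos_left _ (by positivity)

theorem maxW_succ (d : ℕ) : B.maxW (d + 1) = 2 * B.m * B.maxW d * B.len (d + 1) B.e := by
  rw [maxW]

theorem maxW_mono (hb : 0 < B.b) (hm : 0 < B.m) : Monotone B.maxW := by
  refine monotone_nat_of_le_succ fun d => ?_
  rw [maxW_succ, mul_right_comm]
  have := len_pos hb hm (d + 1) B.e
  exact Nat.le_mul_of_pos_left _ (by positivity)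

end BoundParams

theorem mwt_le_length_mul {S : Type*} [Fintype S] [DecidableEq S] {μ : ℤ}
    (x : List (Weights S)) (hx : ∀ a ∈ x, ∀ s t (v : ℤ), a s t = v → v ≤ μ) (s r : S) (v : ℤ)
    (hv : mwt x s r = v) : v ≤ x.length * μ := by
  induction x generalizing s v with
  | nil =>
    by_cases h : s = r
    · have : v = 0 := by simpa [mwt, h, eq_comm] using hv
      simp [this]
    · simp [mwt, h] at hv
  | cons a x ih =>
    obtain ⟨t, ht⟩ := exists_mwt_cons a x s r
    rw [hv, eq_comm, WithTop.add_eq_coe] at ht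
    obtain ⟨a', b', ha, hb, rfl⟩ := ht
    have h1 := hx a List.mem_cons_self s t a' ha.symm
    have h2 := ih (fun c hc => hx c (List.mem_cons_of_mem _ hc)) t b' hb.symm
    push_cast [List.length_cons]
    linarith

theorem Letter.dep_le_wordDep {Q Λ : Type*} {w : List (Letter Q Λ)} {a : Letter Q Λ}
    (ha : a ∈ w) : a.dep ≤ Letter.wordDep w := by
  induction w with
  | nil => simp at ha
  | cons c w ih =>
    simp only [wordDep, List.map_cons, List.foldr_cons] at ih ⊢
    rcases List.mem_cons.mp ha with rfl | h
    · exact le_max_left _ _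
    · exact (ih h).trans (le_max_right _ _)

theorem Letter.dep_cactus {Q Λ : Type*} (S' : Finset (BState Q)) (w : List (Letter Q Λ)) :
    (Letter.cactus S' w).dep = Letter.wordDep w + 1 := by
  rw [dep, wordDep, add_comm]

namespace WFA

variable {Q Λ : Type*} [Fintype Q] [DecidableEq Q]

theorem trnWeight_le_maxBaseWeight [Finite Λ] (A : WFA Q Λ) {p q : Q} {σ : Λ} {s t : BState Q}
    {v : ℤ} (h : A.trnWeight p σ q s t = v) : v ≤ A.maxBaseWeight := by
  have hfin : {k : ℕ | ∃ (p : Q) (σ : Λ) (q : Q) (s t : BState Q) (c : ℤ),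
      A.trnWeight p σ q s t = c ∧ k = c.natAbs}.Finite := by
    refine (Set.finite_range fun x : Q × Λ × Q × BState Q × BState Q =>
      ((A.trnWeight x.1 x.2.1 x.2.2.1 x.2.2.2.1 x.2.2.2.2).untopD 0).natAbs).subset ?_
    rintro k ⟨p, σ, q, s, t, c, hc, rfl⟩
    exact ⟨(p, σ, q, s, t), by simp [hc]⟩
  have := le_csSup hfin.bddAbove ⟨p, σ, q, s, t, v, h, rfl⟩
  have h2 : v ≤ v.natAbs := Int.le_natAbs
  exact h2.trans (by exact_mod_cast this)

/-- The general maximal weight of depth `d` bounds the finite weights of the general bounded cactus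
letters of depth `d`. -/
theorem BoundedCac.le_genMaxW [Finite Λ] {A : WFA Q Λ} {b : ℕ} {a : Letter Q Λ}
    (ha : A.BoundedCac (A.genL b) a) (s t : BState Q) (v : ℤ) (hv : A.letterWeight a s t = v) :
    v ≤ A.genMaxW b a.dep := by
  have hm : 0 < (A.genParams b).m := stabConst_pos s
  induction ha generalizing s t v with
  | trn p σ q =>
    rw [letterWeight] at hv
    rw [Letter.dep, genMaxW, BoundParams.maxW]
    exact trnWeight_le_maxBaseWeight A hv
  | cactus S' w hw _ _ hlen _ ih =>
    rw [letterWeight_cactus] at hv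
    rw [Letter.dep_cactus] at hlen ⊢
    obtain ⟨-, -, g, -, hg⟩ := exists_stabWeight_eq (hv.trans_ne WithTop.coe_ne_top)
    rw [hv, eq_comm, WithTop.add_eq_coe] at hg
    obtain ⟨v₁, v₂, h₁, h₂, rfl⟩ := hg
    set M := (A.genParams b).maxW (Letter.wordDep w) with hM
    have hletters : ∀ c ∈ wordPow (A.tables w) (stabConst (BState Q)), ∀ s t (v : ℤ),
        c s t = v → v ≤ M := by
      intro c hc s t v hv
      obtain ⟨a, ha, rfl⟩ := List.mem_map.mp (mem_of_mem_wordPow hc)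
      refine (ih a ha s t v hv).trans ?_
      -- If the length bounds vanish, then the word `w` is empty.
      have hb : 0 < (A.genParams b).b := by
        by_contra hb
        rw [genL, BoundParams.len_succ_eq_zero (by omega)] at hlen
        have := List.length_pos_of_mem ha
        omega
      exact_mod_cast BoundParams.maxW_mono hb hm (Letter.dep_le_wordDep ha)
    have e₁ := mwt_le_length_mul _ hletters s g v₁ h₁.symm
    have e₂ := mwt_le_length_mul _ hletters g t v₂ h₂.symm
    rw [length_wordPow, tables, List.length_map] at e₁ e₂
    have hle : w.length ≤ (A.genParams b).len (Letter.wordDep w + 1) 0 :=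
      hlen.trans (BoundParams.len_succ_one_le_len_succ_zero hm _)
    have h3 : 2 * stabConst (BState Q) * M * w.length ≤ A.genMaxW b (Letter.wordDep w + 1) := by
      rw [genMaxW, BoundParams.maxW_succ]
      exact Nat.mul_le_mul_left _ hle
    zify at h3
    push_cast at e₁ e₂
    linarith

end WFA

/-! ### Optimal runs -/

section Runs

theorem List.getLastD_append_getLastD {α : Type*} (l l' : List α) (d : α) :
    (l ++ l').getLastD d = l'.getLastD (l.getLastD d) := by
  induction l generalizing d with
  | nil => rfl
  | cons a l ih => rw [List.cons_append, List.getLastD_cons, List.getLastD_cons, ih]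

theorem pathWeight_eq_take_add_drop {S : Type*} (x : List (Weights S)) (s : S) (ts : List S)
    (h : pathWeight s x ts ≠ ⊤) (j : ℕ) :
    pathWeight s x ts = pathWeight s (x.take j) (ts.take j) +
      pathWeight ((ts.take j).getLastD s) (x.drop j) (ts.drop j) := by
  induction x generalizing s ts j with
  | nil =>
    cases ts with
    | nil => simp [pathWeight]
    | cons t ts => simp [pathWeight] at h
  | cons a x ih =>
    cases ts with
    | nil => simp [pathWeight] at h
    | cons t ts =>
      cases j with
      | zero => simp [pathWeight]
      | succ j =>
        simp only [pathWeight, WithTop.add_ne_top] at h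
        simp only [List.take_succ_cons, List.drop_succ_cons, pathWeight, List.getLastD_cons]
        rw [ih t ts h.2 j, add_assoc]

/-- Prefixes of optimal runs are optimal. -/
theorem pathWeight_take_eq_mwt {S : Type*} [Fintype S] [DecidableEq S] (x : List (Weights S))
    (s : S) (ts : List S) (h : pathWeight s x ts ≠ ⊤)
    (hopt : pathWeight s x ts = mwt x s (ts.getLastD s)) (j : ℕ) :
    pathWeight s (x.take j) (ts.take j) = mwt (x.take j) s ((ts.take j).getLastD s) := by
  refine le_antisymm ?_ (mwt_le_pathWeight _ _ _)
  have h1 := pathWeight_eq_take_add_drop x s ts h j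
  have h2 := mwt_append_le (x.take j) (x.drop j) s ((ts.take j).getLastD s) (ts.getLastD s)
  have h3 := mwt_le_pathWeight (x.drop j) ((ts.take j).getLastD s) (ts.drop j)
  rw [← List.getLastD_append_getLastD, List.take_append_drop] at h3
  rw [List.take_append_drop, ← hopt, h1] at h2
  rw [h1, WithTop.add_ne_top] at h
  exact (WithTop.add_le_add_iff_right h.2).mp (h2.trans (add_le_add_right h3 _))

end Runs

/-! ### Changing the baseline -/

namespace BState

variable {Q : Type*}

theorem ext_iff' {s t : BState Q} :
    s = t ↔ s.inner = t.inner ∧ s.base = t.base ∧ s.reach = t.reach := by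
  simp only [Subtype.ext_iff, Prod.ext_iff]

/-- The baseline state with the inner state of `s`. -/
def toBaseline (s : BState Q) : BState Q := s.rebaseTo s.inner s.2.1

end BState

namespace WFA

variable {Q Λ : Type*}

/-- The word which is obtained from a word over the base alphabet when its baseline is replaced by
the inner states of the run `ts`, which starts in a state with inner state `p`. -/
def rebaseWord : Q → List (Letter Q Λ) → List (BState Q) → List (Letter Q Λ)
  | p, .trn _ σ _ :: w, t :: ts => .trn p σ t.inner :: rebaseWord t.inner w ts
  | _, _, _ => []

theorem isTrn_of_mem_rebaseWord (p : Q) (w : List (Letter Q Λ)) (ts : List (BState Q)) :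
    ∀ a ∈ rebaseWord p w ts, a.IsTrn := by
  induction p, w, ts using rebaseWord.induct with
  | case1 p p' σ q w t ts ih =>
    intro a ha
    rw [rebaseWord] at ha
    rcases List.mem_cons.mp ha with rfl | ha
    · trivial
    · exact ih a ha
  | case2 p w ts h =>
    intro a ha
    rw [rebaseWord] at ha
    · simp at ha
    · exact h

variable [Fintype Q] [DecidableEq Q]

/-- Taking the transition `s → e` as the new baseline subtracts its weight from the weights of all
transitions. -/
theorem trnWeight_rebase {A : WFA Q Λ} {p q : Q} {σ : Λ} {s e s₁ s₂ e₁ e₂ : BState Q}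
    (h : A.trnWeight p σ q s e ≠ ⊤) (hs₁ : s₁ ∈ s.fiber) (he₁ : e₁ ∈ e.fiber)
    (hs₂ : s₂.inner = s₁.inner ∧ s₂.base = s.inner ∧ s₂.reach = s₁.reach)
    (he₂ : e₂.inner = e₁.inner ∧ e₂.base = e.inner ∧ e₂.reach = e₁.reach) :
    A.trnWeight s.inner σ e.inner s₂ e₂ + A.trnWeight p σ q s e = A.trnWeight p σ q s₁ e₁ := by
  obtain ⟨h1, h2, h3, h4⟩ := trnWeight_ne_top h
  rw [BState.mem_fiber] at hs₁ he₁
  have hse : A.wt s.inner σ e.inner ≠ ⊤ := by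
    intro h0
    rw [trnWeight, if_pos ⟨h1, h2, h3, h4⟩, h0] at h
    exact h (by simp)
  rw [trnWeight, if_pos ⟨hse, hs₂.2.1, he₂.2.1, by rw [he₂.2.2, he₁.2, h4, hs₂.2.2, hs₁.2]⟩,
    trnWeight, if_pos ⟨h1, h2, h3, h4⟩, trnWeight,
    if_pos ⟨h1, hs₁.1.trans h2, he₁.1.trans h3, by rw [he₁.2, h4, hs₁.2]⟩, hs₂.1, he₂.1]
  obtain ⟨c, hc⟩ := WithTop.ne_top_iff_exists.mp h1
  obtain ⟨c', hc'⟩ := WithTop.ne_top_iff_exists.mp hse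
  rw [← hc, ← hc']
  cases A.wt s₁.inner σ e₁.inner with
  | top => simp
  | coe x =>
    norm_cast
    ring

/-- Taking the run `ts` as the new baseline subtracts its weight from the weights of all runs. -/
theorem mwt_rebaseWord {A : WFA Q Λ} (w : List (Letter Q Λ)) (hw : ∀ a ∈ w, a.IsTrn)
    (s : BState Q) (ts : List (BState Q)) (h : pathWeight s (A.tables w) ts ≠ ⊤)
    {s₁ s₂ r₁ r₂ : BState Q} (hs₁ : s₁ ∈ s.fiber) (hr₁ : r₁ ∈ (ts.getLastD s).fiber)
    (hs₂ : s₂.inner = s₁.inner ∧ s₂.base = s.inner ∧ s₂.reach = s₁.reach)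
    (hr₂ : r₂.inner = r₁.inner ∧ r₂.base = (ts.getLastD s).inner ∧ r₂.reach = r₁.reach) :
    mwt (A.tables (rebaseWord s.inner w ts)) s₂ r₂ + pathWeight s (A.tables w) ts =
      mwt (A.tables w) s₁ r₁ := by
  induction w generalizing s ts s₁ s₂ with
  | nil =>
    cases ts with
    | cons t ts => simp [tables, pathWeight] at h
    | nil =>
      simp only [List.getLastD_nil] at hr₁ hr₂
      have : s₂ = r₂ ↔ s₁ = r₁ := by
        rw [BState.mem_fiber] at hs₁ hr₁
        rw [BState.ext_iff', BState.ext_iff', hs₂.1, hs₂.2.1, hs₂.2.2, hr₂.1, hr₂.2.1, hr₂.2.2,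
          hs₁.1, hr₁.1]
        simp
      simp [rebaseWord, tables, pathWeight, mwt, this]
  | cons a w ih =>
    cases ts with
    | nil => simp [tables, pathWeight] at h
    | cons e ts =>
      obtain ⟨p, σ, q, rfl⟩ : ∃ p σ q, a = .trn p σ q := by
        cases a with
        | trn p σ q => exact ⟨p, σ, q, rfl⟩
        | _ => exact (hw _ List.mem_cons_self).elim
      simp only [tables, List.map_cons, rebaseWord, pathWeight, letterWeight] at ih h ⊢
      rw [List.getLastD_cons] at hr₁ hr₂
      rw [WithTop.add_ne_top] at h
      have ih' := fun {e₁ e₂} (h₁ : e₁ ∈ e.fiber) h₂ =>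
        ih (fun c hc => hw c (List.mem_cons_of_mem _ hc)) e ts h.2 (s₁ := e₁) (s₂ := e₂) h₁ hr₁
          h₂ hr₂
      apply le_antisymm
      · obtain ⟨e₁, he₁⟩ := exists_mwt_cons (A.trnWeight p σ q) (w.map A.letterWeight) s₁ r₁
        rw [he₁]
        by_cases htop : A.trnWeight p σ q s₁ e₁ = ⊤
        · simp [htop]
        have he : e₁ ∈ e.fiber := by
          have h1 := trnWeight_ne_top h.1
          have h2 := trnWeight_ne_top htop
          rw [BState.mem_fiber] at hs₁ ⊢
          exact ⟨h2.2.2.1.trans h1.2.2.1.symm, by rw [h2.2.2.2, h1.2.2.2, hs₁.2]⟩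
        have hmem : e.inner ∈ e₁.reach := (BState.mem_fiber.mp he).2 ▸ e.2.1
        have h₂ : (e₁.rebaseTo e.inner hmem).inner = e₁.inner ∧
          (e₁.rebaseTo e.inner hmem).base = e.inner ∧
          (e₁.rebaseTo e.inner hmem).reach = e₁.reach := ⟨rfl, rfl, rfl⟩
        rw [← ih' he h₂, ← trnWeight_rebase h.1 hs₁ he hs₂ h₂]
        refine (add_le_add_left (mwt_cons_le _ _ _ (e₁.rebaseTo e.inner hmem) _) _).trans
          (le_of_eq ?_)
        abel
      · obtain ⟨e₂, he₂⟩ := exists_mwt_cons (A.trnWeight s.inner σ e.inner)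
          (A.tables (rebaseWord e.inner w ts)) s₂ r₂
        rw [tables] at he₂
        rw [he₂]
        by_cases htop : A.trnWeight s.inner σ e.inner s₂ e₂ = ⊤
        · simp [htop]
        have h1 := trnWeight_ne_top h.1
        have h2 := trnWeight_ne_top htop
        have hreach : e₂.reach = e.reach := by
          rw [h2.2.2.2, h1.2.2.2, hs₂.2.2, (BState.mem_fiber.mp hs₁).2]
        have hmem : e.base ∈ e₂.reach := hreach ▸ e.2.2
        have he : e₂.rebaseTo e.base hmem ∈ e.fiber := BState.mem_fiber.mpr ⟨rfl, hreach⟩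
        have h₂ : e₂.inner = (e₂.rebaseTo e.base hmem).inner ∧ e₂.base = e.inner ∧
          e₂.reach = (e₂.rebaseTo e.base hmem).reach := ⟨rfl, h2.2.2.1, rfl⟩
        refine (mwt_cons_le _ _ _ (e₂.rebaseTo e.base hmem) _).trans (le_of_eq ?_)
        rw [← ih' he h₂, ← trnWeight_rebase h.1 hs₁ he hs₂ h₂]
        abel

/-- The run `ts` becomes a baseline run of weight `0`. -/
theorem pathWeight_rebaseWord {A : WFA Q Λ} (w : List (Letter Q Λ)) (hw : ∀ a ∈ w, a.IsTrn)
    (s : BState Q) (ts : List (BState Q)) (h : pathWeight s (A.tables w) ts ≠ ⊤) :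
    pathWeight s.toBaseline (A.tables (rebaseWord s.inner w ts))
      (ts.map BState.toBaseline) = 0 := by
  induction w generalizing s ts with
  | nil =>
    cases ts with
    | cons t ts => simp [tables, pathWeight] at h
    | nil => simp [rebaseWord, tables, pathWeight]
  | cons a w ih =>
    cases ts with
    | nil => simp [tables, pathWeight] at h
    | cons e ts =>
      obtain ⟨p, σ, q, rfl⟩ : ∃ p σ q, a = .trn p σ q := by
        cases a with
        | trn p σ q => exact ⟨p, σ, q, rfl⟩
        | _ => exact (hw _ List.mem_cons_self).elim
      simp only [tables, List.map_cons, rebaseWord, pathWeight, letterWeight] at ih h ⊢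
      rw [WithTop.add_ne_top] at h
      rw [ih (fun c hc => hw c (List.mem_cons_of_mem _ hc)) e ts h.2, add_zero]
      have h1 := trnWeight_rebase (s₁ := s) (s₂ := s.toBaseline) (e₁ := e) (e₂ := e.toBaseline)
        h.1 (BState.mem_fiber.mpr ⟨rfl, rfl⟩) (BState.mem_fiber.mpr ⟨rfl, rfl⟩)
        ⟨rfl, rfl, rfl⟩ ⟨rfl, rfl, rfl⟩
      exact (WithTop.add_right_inj h.1).mp (h1.trans (zero_add _).symm)

/-- If the baseline of a word over the base alphabet is replaced by an optimal run, the resulting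
word is admissible. -/
theorem isAdmissible_rebaseWord {A : WFA Q Λ} {w : List (Letter Q Λ)} (hw : ∀ a ∈ w, a.IsTrn)
    {ts : List (BState Q)} (h : pathWeight A.init' (A.tables w) ts ≠ ⊤)
    (hopt : pathWeight A.init' (A.tables w) ts = mwt (A.tables w) A.init' (ts.getLastD A.init')) :
    A.IsAdmissible (rebaseWord A.init w ts) := by
  have hself : ∀ s : BState Q, s ∈ s.fiber := fun s => BState.mem_fiber.mpr ⟨rfl, rfl⟩
  have h0 : pathWeight A.init' _ _ = 0 := pathWeight_rebaseWord w hw A.init' ts h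
  refine ⟨fun a ha => ?_, ts.map BState.toBaseline, h0.trans_ne (by simp), ?_, fun j _ => ?_⟩
  · have := isTrn_of_mem_rebaseWord A.init w ts a ha
    cases a <;> simp_all [Letter.IsTrn, Letter.IsJump]
  · simp only [List.mem_map]
    rintro _ ⟨t, -, rfl⟩
    rfl
  · have htake : A.tables ((rebaseWord A.init w ts).take j) =
        (A.tables (rebaseWord A.init w ts)).take j := List.map_take
    rw [htake]
    refine pathWeight_take_eq_mwt _ _ _ (h0.trans_ne (by simp)) (h0.trans ?_) j
    have h1 := mwt_rebaseWord w hw A.init' ts h (s₂ := A.init')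
      (r₂ := (ts.getLastD A.init').toBaseline) (hself _) (hself _) ⟨rfl, rfl, rfl⟩ ⟨rfl, rfl, rfl⟩
    have h2 : (ts.map BState.toBaseline).getLastD A.init'.toBaseline =
        (ts.getLastD A.init').toBaseline := List.getLastD_map
    change _ = mwt _ _ ((ts.map BState.toBaseline).getLastD A.init'.toBaseline)
    rw [h2]
    rw [← hopt] at h1
    exact ((WithTop.add_right_inj h).mp (h1.trans (zero_add _).symm)).symm

end WFA

/-! ### Dominant states -/

namespace WFA

variable {Q Λ : Type*} [Fintype Q] [DecidableEq Q]

/-- The cactus letter of the empty word on the fiber of `r`. Its transitions are the loops of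
weight `0` in this fiber, so it can be appended whenever a word has to end in a cactus letter. -/
theorem boundedCacRebCac_nil (A : WFA Q Λ) (L : ℕ → ℕ) (r : BState Q) :
    A.BoundedCacRebCac L (.cactus r.fiber []) ∧
      A.letterWeight (.cactus r.fiber []) r r ≠ ⊤ := by
  have hpow : ∀ n, wordPow ([] : List (Weights (BState Q))) n = [] := fun n => by
    simp [wordPow]
  have hr : r ∈ r.fiber := BState.mem_fiber.mpr ⟨rfl, rfl⟩
  have hmin : ∀ n, ∀ t ∈ r.fiber,
      IsMinState r.fiber (wordPow ([] : List (Weights (BState Q))) n) t := by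
    intro n t ht
    rw [hpow]
    exact ⟨⟨ht, by simp [mwt]⟩, fun _ _ => by simp [mwt]⟩
  refine ⟨⟨r.fiber, [], rfl, by simp, ?_, by simp⟩, ?_⟩
  · refine ⟨⟨(r.base, r.base, r.reach), r.2.2, r.2.2⟩, rfl,
      (BState.fiber_eq_of_mem (BState.mem_fiber.mpr ⟨rfl, rfl⟩)).symm, fun t ht t' h => ?_,
      fun n => ⟨hmin n _ (BState.mem_fiber.mpr ⟨rfl, rfl⟩), ?_⟩⟩
    · have : t = t' := by by_contra h0; simp [tables, mwt, h0] at h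
      exact this ▸ ht
    · change mwt (wordPow [] n) _ _ = 0
      rw [hpow]
      simp [mwt]
  · rw [letterWeight_cactus]
    refine ne_top_of_le_ne_top ?_ (stabWeight_le hr hr (hmin _ r hr))
    change mwt (wordPow [] _) _ _ + mwt (wordPow [] _) _ _ ≠ ⊤
    rw [hpow]
    simp [mwt]

/-- A word which consists of a bounded cactus letter can be continued from the target of each of
its transitions such that it ends in a cactus letter. -/
theorem BoundedCac.exists_continuation {A : WFA Q Λ} {L : ℕ → ℕ} {a : Letter Q Λ}
    (ha : A.BoundedCac L a) {q r : BState Q} (h : A.letterWeight a q r ≠ ⊤) :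
    ∃ (y w : List (Letter Q Λ)) (α : Letter Q Λ), a :: y = w ++ [α] ∧ (∀ c ∈ w, c.IsTrn) ∧
      A.BoundedCacRebCac L α ∧ mwt (A.tables (a :: y)) q r ≠ ⊤ := by
  cases ha with
  | trn p σ p' =>
    obtain ⟨h1, h2⟩ := boundedCacRebCac_nil A L r
    refine ⟨[.cactus r.fiber []], [.trn p σ p'], _, rfl, by simp [Letter.IsTrn], h1, ?_⟩
    refine ne_top_of_le_ne_top ?_ (mwt_append_le [A.letterWeight (.trn p σ p')]
      [A.letterWeight (.cactus r.fiber [])] q r r)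
    rw [mwt_singleton, mwt_singleton, WithTop.add_ne_top]
    exact ⟨h, h2⟩
  | cactus S' w hw hstable _ hlen _ =>
    refine ⟨[], [], .cactus S' w, rfl, by simp, ⟨S', w, rfl, fun c hc => Or.inl (hw c hc),
      hstable, by rwa [← Letter.dep_cactus S' w]⟩, ?_⟩
    simpa [tables, mwt_singleton] using h

theorem letterWeight_jump_eq_zero {A : WFA Q Λ} {s r t g : BState Q} (h : t.inner = g.inner)
    (ht : t ∈ s.fiber) (hg : g ∈ r.fiber) (hsr : s.reach = r.reach) :
    A.letterWeight (.jump s r) t g = 0 := by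
  rw [BState.mem_fiber] at ht hg
  rw [letterWeight]
  exact if_pos ⟨h, ht.1, ht.2, hg.1, hg.2.trans hsr.symm⟩

theorem of_letterWeight_jump_ne_top {A : WFA Q Λ} {s r t g : BState Q}
    (h : A.letterWeight (.jump s r) t g ≠ ⊤) :
    t.inner = g.inner ∧ g.base = r.base ∧ g.reach = t.reach := by
  by_cases h' : t.inner = g.inner ∧ t.base = s.base ∧ t.reach = s.reach ∧
      g.base = r.base ∧ g.reach = s.reach
  · exact ⟨h'.1, h'.2.2.2.1, h'.2.2.2.2.trans h'.2.2.1.symm⟩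
  · rw [letterWeight] at h
    exact absurd (if_neg h') h

theorem le_potential {A : WFA Q Λ} {b : ℕ} {w : List (Letter Q Λ)} {q : BState Q} {x : ℤ}
    (hq : A.IsDominant b (A.conf w) q) (hx : A.conf w q = x) : x ≤ A.potential b w := by
  have hfin : {x : ℤ | ∃ q, A.IsDominant b (A.conf w) q ∧ A.conf w q = x}.Finite := by
    refine (Set.finite_range fun q => (A.conf w q).untopD 0).subset ?_
    rintro x ⟨q, -, hx⟩
    exact ⟨q, by simp [hx]⟩
  exact le_csSup hfin.bddAbove ⟨q, hq, hx⟩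

theorem IsAdmissible.exists_conf_ne_top {A : WFA Q Λ} {w : List (Letter Q Λ)}
    (h : A.IsAdmissible w) : ∃ r, A.conf w r ≠ ⊤ := by
  obtain ⟨-, ts, hts, -⟩ := h
  exact ⟨_, ne_top_of_le_ne_top hts (mwt_le_pathWeight (A.tables w) A.init' ts)⟩

theorem exists_conf_eq_neg_charge {A : WFA Q Λ} {w : List (Letter Q Λ)}
    (h : ∃ r, A.conf w r ≠ ⊤) :
    ∃ x, A.conf w x = ((-A.charge w : ℤ) : WithTop ℤ) ∧ ∀ y, A.conf w x ≤ A.conf w y := by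
  obtain ⟨r, hr⟩ := h
  obtain ⟨x, -, hx⟩ := Finset.exists_mem_eq_inf (Finset.univ : Finset (BState Q))
    ⟨r, Finset.mem_univ r⟩ (A.conf w)
  have hle : ∀ y, A.conf w x ≤ A.conf w y := fun y => hx ▸ Finset.inf_le (Finset.mem_univ y)
  refine ⟨x, ?_, hle⟩
  obtain ⟨v, hv⟩ := WithTop.ne_top_iff_exists.mp (ne_top_of_le_ne_top hr (hle r))
  rw [charge, hx, ← hv]
  simp

/-- Let `q` be a state of minimal value `v` among the states from which the letter `σ` can be read.
If a word over the base alphabet approximates `u` from the initial state with a threshold above `v`,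
and its baseline is replaced by an optimal run to a state `e`, then the state that corresponds to
`q` is dominant: the jump back to the original baseline, followed by `σ`, can be read from it, and
from no state of smaller value. -/
theorem isDominant_rebaseWord {A : WFA Q Λ} {b : ℕ} {u w : List (Letter Q Λ)} {σ : Letter Q Λ}
    (hσ : A.BoundedCac (A.genL b) σ) {q e : BState Q} {v m : ℤ} (hv : A.conf u q = v)
    (hq : ∃ r, A.letterWeight σ q r ≠ ⊤)
    (hqmin : ∀ p, A.conf u p < A.conf u q → ∀ r, A.letterWeight σ p r = ⊤)
    (hw : ∀ a ∈ w, a.IsTrn)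
    (happ : ∀ p, Approx (v + 1) (A.conf w p) (A.conf u p))
    {ts : List (BState Q)} (hts : pathWeight A.init' (A.tables w) ts = m)
    (he : ts.getLastD A.init' = e) (heq : q ∈ e.fiber) :
    ∃ q', A.IsDominant b (A.conf (rebaseWord A.init w ts)) q' ∧
      A.conf (rebaseWord A.init w ts) q' = ((v - m : ℤ) : WithTop ℤ) := by
  have hself : ∀ s : BState Q, s ∈ s.fiber := fun s => BState.mem_fiber.mpr ⟨rfl, rfl⟩
  have htop : pathWeight A.init' (A.tables w) ts ≠ ⊤ := hts.trans_ne WithTop.coe_ne_top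
  -- The values of corresponding states differ by `m`.
  have hconf : ∀ r₁ ∈ e.fiber, ∀ r₂ : BState Q, r₂.inner = r₁.inner → r₂.base = e.inner →
      r₂.reach = r₁.reach → A.conf (rebaseWord A.init w ts) r₂ + m = A.conf w r₁ := by
    intro r₁ h₁ r₂ h2 h3 h4
    have := mwt_rebaseWord w hw A.init' ts htop (s₁ := A.init') (s₂ := A.init') (r₁ := r₁)
      (r₂ := r₂) (hself _) (he ▸ h₁) ⟨rfl, rfl, rfl⟩ ⟨h2, he ▸ h3, h4⟩
    rwa [hts] at this
  have hmem : e.inner ∈ q.reach := (BState.mem_fiber.mp heq).2 ▸ e.2.1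
  set q' := q.rebaseTo e.inner hmem with hq'
  have hwq : A.conf w q = v := by
    rcases happ q with h | h
    · rw [h, hv]
    · rw [hv] at h
      exact absurd h.1 WithTop.coe_ne_top
  have hq'v : A.conf (rebaseWord A.init w ts) q' = ((v - m : ℤ) : WithTop ℤ) := by
    have h1 := hconf q heq q' rfl rfl rfl
    rw [hwq, WithTop.add_eq_coe] at h1
    obtain ⟨c, m', h2, h3, h4⟩ := h1
    rw [← h2, WithTop.coe_inj]
    have := WithTop.coe_inj.mp h3
    omega
  refine ⟨q', ⟨hq'v.trans_ne WithTop.coe_ne_top, ?_⟩, hq'v⟩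
  obtain ⟨r, hr⟩ := hq
  obtain ⟨y, z, α, hy, hz, hα, hread⟩ := hσ.exists_continuation hr
  have hqe := BState.mem_fiber.mp heq
  refine ⟨.jump e.toBaseline e :: z, α, ?_, hα, ⟨r, ?_⟩, ?_⟩
  · intro a ha
    rcases List.mem_cons.mp ha with rfl | ha
    · exact Or.inr ⟨rfl, rfl⟩
    · have := hz a ha
      cases a with
      | trn p τ p' => exact Or.inl (Or.inl (.trn p τ p'))
      | _ => exact this.elim
  · rw [List.cons_append, ← hy]
    refine ne_top_of_le_ne_top ?_ (mwt_cons_le (A.letterWeight (.jump e.toBaseline e))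
      (A.tables (σ :: y)) q' q r)
    have hjump : A.letterWeight (.jump e.toBaseline e) q' q = 0 :=
      letterWeight_jump_eq_zero rfl (BState.mem_fiber.mpr ⟨rfl, hqe.2⟩) heq rfl
    rw [hjump, zero_add]
    exact hread
  · intro p hp r'
    rw [List.cons_append, ← hy]
    by_contra hne
    obtain ⟨g, hg⟩ := exists_mwt_cons (A.letterWeight (.jump e.toBaseline e))
      (A.tables (σ :: y)) p r'
    change mwt (A.letterWeight (.jump e.toBaseline e) :: A.tables (σ :: y)) p r' ≠ ⊤ at hne
    rw [hg, WithTop.add_ne_top] at hne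
    obtain ⟨hjump, hne⟩ := hne
    obtain ⟨g', hg'⟩ := exists_mwt_cons (A.letterWeight σ) (A.tables y) g r'
    change mwt (A.letterWeight σ :: A.tables y) g r' ≠ ⊤ at hne
    rw [hg', WithTop.add_ne_top] at hne
    obtain ⟨h1, h2, h3⟩ := of_letterWeight_jump_ne_top hjump
    -- Since `p` is reached, its baseline component is the inner state of `e`.
    have hpf : p ∈ q'.fiber := mem_fiber_of_forall_isTrn (isTrn_of_mem_rebaseWord A.init w ts)
      (hself A.init') (hq'v.trans_ne WithTop.coe_ne_top) (ne_top_of_lt hp)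
    rw [BState.mem_fiber] at hpf
    have hge : g ∈ e.fiber := BState.mem_fiber.mpr ⟨h2, by rw [h3, hpf.2]; exact hqe.2⟩
    have hgv := hconf g hge p h1 hpf.1 h3.symm
    have hlt : A.conf w g < v := by
      rw [hq'v] at hp
      cases hc : A.conf (rebaseWord A.init w ts) p with
      | top => rw [hc] at hp; exact absurd hp not_top_lt
      | coe c =>
        rw [hc, WithTop.coe_lt_coe] at hp
        rw [← hgv, hc, ← WithTop.coe_add, WithTop.coe_lt_coe]
        omega
    rcases happ g with h | ⟨-, h⟩
    · exact hne.1 (hqmin g (by rwa [← h, hv]) g')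
    · exact absurd (h.trans_lt hlt) (by rw [WithTop.coe_lt_coe]; omega)

end WFA

/-! ### A large drop of the charge -/

theorem mainTheorem8 {Q Λ : Type*} [Fintype Q] [DecidableEq Q] [Finite Λ] (A : WFA Q Λ)
    (b P d : ℕ) (u : List (Letter Q Λ)) (σ : Letter Q Λ)
    (hu : ∀ a ∈ u, A.BoundedCac (A.genL b) a) (hσ : A.BoundedCac (A.genL b) σ)
    (hd : σ.dep = d)
    (hadm_u : A.IsAdmissible u) (hadm : A.IsAdmissible (u ++ [σ]))
    (hdrop : A.charge u - A.charge (u ++ [σ]) > (P : ℤ) + 2 * (A.genMaxW b d : ℤ)) :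
    ∃ w : List (Letter Q Λ), (∀ a ∈ w, a.IsTrn) ∧ A.IsAdmissible w ∧
      A.potential b w > (P : ℤ) := by
  obtain ⟨e, he, -⟩ := WFA.exists_conf_eq_neg_charge hadm_u.exists_conf_ne_top
  have hconf : ∀ r, ∃ q, A.conf (u ++ [σ]) r = A.conf u q + A.letterWeight σ q r := by
    intro r
    have := exists_mwt_append (A.tables u) [A.letterWeight σ] A.init' r
    rw [mwt_singleton] at this
    rwa [WFA.conf, WFA.tables_append]
  -- `q` has minimal value among the states from which `σ` can be read.
  obtain ⟨q, ⟨hq, r, hr⟩, hqmin⟩ : ∃ q, (A.conf u q ≠ ⊤ ∧ ∃ r, A.letterWeight σ q r ≠ ⊤) ∧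
      ∀ p, A.conf u p < A.conf u q → ∀ r, A.letterWeight σ p r = ⊤ := by
    obtain ⟨r, hr⟩ := hadm.exists_conf_ne_top
    obtain ⟨q₀, hq₀⟩ := hconf r
    rw [hq₀, WithTop.add_ne_top] at hr
    obtain ⟨q, hq, hmin⟩ := Set.exists_min_image
      {q | A.conf u q ≠ ⊤ ∧ ∃ r, A.letterWeight σ q r ≠ ⊤} (A.conf u) (Set.toFinite _)
      ⟨q₀, hr.1, r, hr.2⟩
    refine ⟨q, hq, fun p hp r => ?_⟩
    by_contra hne
    exact absurd (hmin p ⟨ne_top_of_lt hp, r, hne⟩) (not_le.mpr hp)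
  obtain ⟨v, hv⟩ := WithTop.ne_top_iff_exists.mp hq
  obtain ⟨c, hc⟩ := WithTop.ne_top_iff_exists.mp hr
  have hgap : v + A.charge u > P := by
    obtain ⟨x, hx, hmin⟩ := WFA.exists_conf_eq_neg_charge hadm.exists_conf_ne_top
    have h1 : c ≤ A.genMaxW b d := hd ▸ hσ.le_genMaxW q r c hc.symm
    have h2 : A.conf (u ++ [σ]) r ≤ A.conf u q + A.letterWeight σ q r := by
      have := mwt_append_le (A.tables u) [A.letterWeight σ] A.init' q r
      rw [mwt_singleton] at this
      rwa [WFA.conf, WFA.tables_append]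
    have h3 := (hmin r).trans h2
    rw [hx, ← hv, ← hc, ← WithTop.coe_add, WithTop.coe_le_coe] at h3
    omega
  obtain ⟨w, hw, happ⟩ := WFA.isUnfoldable_mwt (fun a ha => (hu a ha).isUnfoldable) A.init' e
    (he.trans_ne WithTop.coe_ne_top) (v + 1)
  have happ' : ∀ p, Approx (v + 1) (A.conf w p) (A.conf u p) :=
    happ A.init' (BState.mem_fiber.mpr ⟨rfl, rfl⟩)
  have heq : ∀ p, A.conf u p ≠ ⊤ → A.conf w p = A.conf u p := fun p hp =>
    (happ' p).resolve_right fun h => hp h.1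
  have hwe := heq e (he.trans_ne WithTop.coe_ne_top)
  have hwe' : A.conf w e ≠ ⊤ := hwe.trans_ne (he.trans_ne WithTop.coe_ne_top)
  obtain ⟨ts, hts, hopt⟩ := exists_pathWeight_eq_mwt (A.tables w) A.init' e hwe'
  have hm : pathWeight A.init' (A.tables w) ts = ((-A.charge u : ℤ) : WithTop ℤ) :=
    hopt.trans (hwe.trans he)
  have hqe : q ∈ e.fiber := WFA.mem_fiber_of_forall_isTrn hw
    (BState.mem_fiber.mpr ⟨rfl, rfl⟩ : A.init' ∈ A.init'.fiber) hwe' ((heq q hq).trans_ne hq)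
  obtain ⟨q', hdom, hval⟩ := WFA.isDominant_rebaseWord hσ hv.symm ⟨r, hr⟩ hqmin hw happ' hm hts hqe
  refine ⟨WFA.rebaseWord A.init w ts, WFA.isTrn_of_mem_rebaseWord _ _ _,
    WFA.isAdmissible_rebaseWord hw (hm.trans_ne WithTop.coe_ne_top) (by rw [hopt, hts]), ?_⟩
  have := WFA.le_potential hdom hval
  omega
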